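/- **Setting.** Let $T>0$, $q\ge p$. Consider the system $Y_k(s)=G_1(s)U_k(s)+G_2(s)D(s)$ for signals on $[0,T]$, where $G_1\in\mathbb{R}(s)^{q\times p}$ and $G_2\in\mathbb{R}(s)^{q\times m}$ are strictly proper (limit $0$ as $s\to\infty$), $D(s)=d_0+\widehat D(s)$ with $d_0\in\mathbb{R}^m$ and $\widehat D\in\mathbb{R}(s)^{m}$ strictly proper, and $G_1$ has relative degree one, i.e. $\lim_{s\to\infty}sG_1(s)$ has full (column) rank. Put $\Phi_i=\mathcal{L}^{-1}[G_i]$, $\widehat d=\mathcal{L}^{-1}[\widehat D]$. For $\Gamma\in\mathbb{R}(s)^{p\times q}$ apply the updating law $U_{k+1}=U_k+\Gamma E_k$, $E_k=Y_d-Y_k$, with initial input $U_0=\mathcal{L}[u_0]$, $u_0\in C_p[0,T]$, where $y_d\in C^1_q[0,T]$ satisfies the initial condition that $y_d(0)$ is the common initial value of all outputs of the system. All identities between Laplace transforms are understood on $[0,T]$, i.e. modulo terms that are $O(e^{-\sigma s})$ as $s\to\infty$ for every $\sigma<T$. Call $y_d$ *trackable* if $G_1U_d=Y_d-G_2D$ for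 some (integrable) input $u_d$. "Proper" means: has a finite limit as $s\to\infty$. Say that the law *generates continuous inputs* for $y_d$ if, for each $u_0\in C_p[0,T]$, every $U_k$ is the transform of some $u_k\in C_p[0,T]$. For $u\in C_p[0,T]$ write $$R[u](t)=\int_0^t\Phi_1(t-\tau)u(\tau)\,d\tau+\int_0^t\Phi_2(t-\tau)\widehat d(\tau)\,d\tau+\Phi_2(t)d_0 .$$ Say that *the law converges from $u_0$ to $u_\infty$* if $u_\infty\in C_p[0,T]$, $y_\infty:=R[u_\infty]\in C^1_q[0,T]$, every $U_k$, $Y_k$ is the transform of a continuous $u_k$, $y_k$, and $u_k\to u_\infty$, $y_k\to y_\infty$ on $[0,T]$. Let (DC) denote the condition $$\Gamma G_1\ \text{is proper and}\ \rho\Bigl(I-\lim_{s\to\infty}\Gamma(s)G_1(s)\Bigr)<1 .$$ **Theorem.** 1. For every such $y_d$ the following are equivalent: (a) there is $u_\infty$ to which the law converges pointwise from every $u_0\in C_p[0,T]$; (b) the same with uniform convergence of $u_k$ and $y_k$ on $[0,T]$; (c) $\Gamma G_1$ is nonsingular and for every $u_0\in C_p[0,T]$ there is $u_\infty$ (a priori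 depending on $u_0$) to which the law converges uniformly from $u_0$; (d) the law generates continuous inputs for $y_d$, and (DC) holds. 2. The law generates continuous inputs for $y_d$ if $s^{-1}\Gamma(s)$ is proper, and also if $\Gamma G_1$ is proper and, in addition, $q=p$ or $y_d$ is trackable. 3. The convergence (b) takes place for all such $y_d$ if and only if $s^{-1}\Gamma(s)$ is proper and (DC) holds. 4. Assume (DC). Then $\Gamma G_1$ and $G_1^{\mathsf T}G_1$ are nonsingular. For every such $y_d$ for which the law generates continuous inputs, the limit $u_\infty$ of (b) satisfies $U_\infty=(\Gamma G_1)^{-1}\Gamma\,[Y_d-G_2D]$. For every $u_0$, one has $\lim_k y_k(t)=y_d(t)$ for all $t\in[0,T]$ if and only if $y_d$ is trackable, and in this case $U_\infty=U_d=(G_1^{\mathsf T}G_1)^{-1}G_1^{\mathsf T}[Y_d-G_2D]$. In general $e_k=y_d-y_k$ converges uniformly to a continuous $e_\infty$ with $E_\infty=\{I-G_1(\Gamma G_1)^{-1}\Gamma\}[Y_d-G_2D]$, and $e_\infty\neq0$ if $y_d$ is not trackable. -/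

import Mathlib

open Filter Topology Asymptotics Set MeasureTheory
open scoped Matrix

noncomputable section

namespace ILC

/-- Matrices of real rational functions in `s`. -/
abbrev RatMat (a b : ℕ) := Matrix (Fin a) (Fin b) (RatFunc ℝ)

/-- The value of a rational function at the real point `s`. -/
def ev (r : RatFunc ℝ) (s : ℝ) : ℝ := RatFunc.eval (RingHom.id ℝ) s r

/-- The value of a rational matrix at the real point `s`. -/
def evM {a b : ℕ} (R : RatMat a b) (s : ℝ) : Matrix (Fin a) (Fin b) ℝ :=
  Matrix.of fun i j => ev (R i j) s

/-- `lim_{s → ∞} R(s) = L`. -/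
def HasLimit {a b : ℕ} (R : RatMat a b) (L : Matrix (Fin a) (Fin b) ℝ) : Prop :=
  Tendsto (fun s : ℝ => evM R s) atTop (𝓝 L)

/-- `R(s)` has a finite limit as `s → ∞`. -/
def Proper {a b : ℕ} (R : RatMat a b) : Prop := ∃ L, HasLimit R L

def StrictlyProper {a b : ℕ} (R : RatMat a b) : Prop := HasLimit R 0

/-- Relative degree one: `s R(s)` tends to a matrix of full rank as `s → ∞`. -/
def RelativeDegreeOne {a b : ℕ} (R : RatMat a b) : Prop :=
  ∃ M : Matrix (Fin a) (Fin b) ℝ,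
    Tendsto (fun s : ℝ => s • evM R s) atTop (𝓝 M) ∧ M.rank = min a b

/-- `s⁻¹ R(s)` has a finite limit as `s → ∞`. -/
def ProperAfterIntegration {a b : ℕ} (R : RatMat a b) : Prop :=
  ∃ L : Matrix (Fin a) (Fin b) ℝ, Tendsto (fun s : ℝ => s⁻¹ • evM R s) atTop (𝓝 L)

/-- The spectral radius of a real square matrix: the largest modulus of its complex eigenvalues. -/
def rho {n : ℕ} (M : Matrix (Fin n) (Fin n) ℝ) : ENNReal :=
  spectralRadius ℂ (M.map (algebraMap ℝ ℂ))

/-- The Laplace transform (at real `s`) of a signal on `[0, T]`. -/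
def laplace (T : ℝ) {n : ℕ} (f : ℝ → Fin n → ℝ) (s : ℝ) : Fin n → ℝ :=
  ∫ t in (0 : ℝ)..T, Real.exp (-(s * t)) • f t

/-- Equality of Laplace-domain expressions as far as the time interval `[0, T]` is concerned.
Changing a signal after time `T` changes its transform by a term which is `O(exp (-σ s))` for
every `σ < T`, and conversely, signals whose transforms differ by such a term agree on `[0, T]`. -/
def EqUpTo (T : ℝ) {n : ℕ} (F H : ℝ → Fin n → ℝ) : Prop :=
  ∀ σ < T, (fun s : ℝ => F s - H s) =O[atTop] fun s : ℝ => Real.exp (-(σ * s))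

/-- On `[0, T]`, the Laplace-domain expression `F` is the transform of the continuous signal `f`. -/
def Represents (T : ℝ) {n : ℕ} (F : ℝ → Fin n → ℝ) (f : ℝ → Fin n → ℝ) : Prop :=
  ContinuousOn f (Icc 0 T) ∧ EqUpTo T F (laplace T f)

/-- `f` is continuous on `[0, ∞)` and its Laplace transform is the rational function `r`. -/
def IsInvLaplace (f : ℝ → ℝ) (r : RatFunc ℝ) : Prop :=
  ContinuousOn f (Ici 0) ∧
    ∀ᶠ s : ℝ in atTop, IntegrableOn (fun t : ℝ => Real.exp (-(s * t)) * f t) (Ioi 0) ∧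
      ∫ t in Ioi (0 : ℝ), Real.exp (-(s * t)) * f t = ev r s

open Classical in
/-- The inverse Laplace transform of a strictly proper rational function, a function on `[0, ∞)`
(every strictly proper `r` has exactly one continuous inverse transform on `[0, ∞)`). -/
def invLaplace (r : RatFunc ℝ) : ℝ → ℝ :=
  if h : ∃ f, IsInvLaplace f r then h.choose else fun _ => 0

/-- The data of the system `Y = G₁ U + G₂ D` with `D = d₀ + Dh`. -/
structure Plant (q p m : ℕ) where
  G₁ : RatMat q p
  G₂ : RatMat q m
  d₀ : Fin m → ℝ
  Dh : Fin m → RatFunc ℝ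

variable {q p m : ℕ}

namespace Plant

/-- `G₂(s) D(s)` with `D(s) = d₀ + Dh(s)`. -/
def disturbance (S : Plant q p m) (s : ℝ) : Fin q → ℝ :=
  evM S.G₂ s *ᵥ (S.d₀ + fun i => ev (S.Dh i) s)

/-- `Y(s) = G₁(s) U(s) + G₂(s) D(s)`. -/
def output (S : Plant q p m) (U : ℝ → Fin p → ℝ) (s : ℝ) : Fin q → ℝ :=
  evM S.G₁ s *ᵥ U s + S.disturbance s

def Φ₁ (S : Plant q p m) (t : ℝ) : Matrix (Fin q) (Fin p) ℝ :=
  Matrix.of fun i j => invLaplace (S.G₁ i j) t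

def Φ₂ (S : Plant q p m) (t : ℝ) : Matrix (Fin q) (Fin m) ℝ :=
  Matrix.of fun i j => invLaplace (S.G₂ i j) t

def dh (S : Plant q p m) (t : ℝ) : Fin m → ℝ := fun i => invLaplace (S.Dh i) t

/-- The time-domain response `Φ₁ * u + Φ₂ * dh + Φ₂ d₀`. -/
def response (S : Plant q p m) (u : ℝ → Fin p → ℝ) (t : ℝ) : Fin q → ℝ :=
  (∫ τ in (0 : ℝ)..t, S.Φ₁ (t - τ) *ᵥ u τ) + (∫ τ in (0 : ℝ)..t, S.Φ₂ (t - τ) *ᵥ S.dh τ)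
    + S.Φ₂ t *ᵥ S.d₀

/-- `y_d` starts where every output of the system starts. -/
def InitialCondition (S : Plant q p m) (T : ℝ) (yd : ℝ → Fin q → ℝ) : Prop :=
  ∀ (u : ℝ → Fin p → ℝ) (y : ℝ → Fin q → ℝ), ContinuousOn u (Icc 0 T) →
    Represents T (S.output (laplace T u)) y → yd 0 = y 0

/-- `y_d ∈ C¹[0, T]` satisfies the initial condition. -/
def Admissible (S : Plant q p m) (T : ℝ) (yd : ℝ → Fin q → ℝ) : Prop :=
  ContDiffOn ℝ 1 yd (Icc 0 T) ∧ S.InitialCondition T yd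

/-- `Y_d(s) - G₂(s) D(s)`. -/
def residual (S : Plant q p m) (T : ℝ) (yd : ℝ → Fin q → ℝ) (s : ℝ) : Fin q → ℝ :=
  laplace T yd s - S.disturbance s

/-- `y_d` is trackable: `G₁ U_d = Y_d - G₂ D` for some input `u_d`. -/
def Trackable (S : Plant q p m) (T : ℝ) (yd : ℝ → Fin q → ℝ) : Prop :=
  ∃ ud : ℝ → Fin p → ℝ, IntegrableOn ud (Icc 0 T) ∧
    EqUpTo T (fun s => evM S.G₁ s *ᵥ laplace T ud s) (S.residual T yd)

/-- The inputs `U_k(s)` of the updating law `U_{k+1} = U_k + Γ E_k`, `E_k = Y_d - Y_k`,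
started at `U_0 = 𝓛[u_0]`. -/
def ilcInput (S : Plant q p m) (Γ : RatMat p q) (T : ℝ) (yd : ℝ → Fin q → ℝ)
    (u₀ : ℝ → Fin p → ℝ) : ℕ → ℝ → Fin p → ℝ
  | 0 => laplace T u₀
  | k + 1 => fun s => ilcInput S Γ T yd u₀ k s +
      evM Γ s *ᵥ (laplace T yd s - S.output (ilcInput S Γ T yd u₀ k) s)

/-- `u_k`, `y_k` are the (continuous) time-domain inputs and outputs of the updating law. -/
def IsRun (S : Plant q p m) (Γ : RatMat p q) (T : ℝ) (yd : ℝ → Fin q → ℝ) (u₀ : ℝ → Fin p → ℝ)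
    (u : ℕ → ℝ → Fin p → ℝ) (y : ℕ → ℝ → Fin q → ℝ) : Prop :=
  ∀ k, Represents T (S.ilcInput Γ T yd u₀ k) (u k) ∧
    Represents T (S.output (S.ilcInput Γ T yd u₀ k)) (y k)

/-- The updating law generates continuous inputs only, from every continuous initial input. -/
def ContinuousInputs (S : Plant q p m) (Γ : RatMat p q) (T : ℝ) (yd : ℝ → Fin q → ℝ) : Prop :=
  ∀ u₀ : ℝ → Fin p → ℝ, ContinuousOn u₀ (Icc 0 T) →
    ∀ k, ∃ uk, Represents T (S.ilcInput Γ T yd u₀ k) uk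

/-- All `u_k` are continuous, `u_k → u_∞` pointwise on `[0, T]` with `u_∞` continuous, and
`y_k → y_∞` pointwise with `y_∞ ∈ C¹[0, T]` the response to `u_∞`. -/
def ConvergesPointwise (S : Plant q p m) (Γ : RatMat p q) (T : ℝ) (yd : ℝ → Fin q → ℝ)
    (u₀ uinf : ℝ → Fin p → ℝ) : Prop :=
  ContinuousOn uinf (Icc 0 T) ∧ ContDiffOn ℝ 1 (S.response uinf) (Icc 0 T) ∧
    ∃ u y, S.IsRun Γ T yd u₀ u y ∧
      (∀ t ∈ Icc 0 T, Tendsto (fun k => u k t) atTop (𝓝 (uinf t))) ∧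
      (∀ t ∈ Icc 0 T, Tendsto (fun k => y k t) atTop (𝓝 (S.response uinf t)))

/-- The same with uniform convergence on `[0, T]`. -/
def ConvergesUniformly (S : Plant q p m) (Γ : RatMat p q) (T : ℝ) (yd : ℝ → Fin q → ℝ)
    (u₀ uinf : ℝ → Fin p → ℝ) : Prop :=
  ContinuousOn uinf (Icc 0 T) ∧ ContDiffOn ℝ 1 (S.response uinf) (Icc 0 T) ∧
    ∃ u y, S.IsRun Γ T yd u₀ u y ∧
      TendstoUniformlyOn u uinf atTop (Icc 0 T) ∧
      TendstoUniformlyOn y (S.response uinf) atTop (Icc 0 T)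

/-- `Γ G₁` is proper and `ρ(I - lim_{s → ∞} Γ(s) G₁(s)) < 1`. -/
def DesignCondition (S : Plant q p m) (Γ : RatMat p q) : Prop :=
  ∃ L : Matrix (Fin p) (Fin p) ℝ, HasLimit (Γ * S.G₁) L ∧ rho (1 - L) < 1

end Plant

end ILC

end

/-!
Both the plant and the updating law act on signals only through proper rational matrices, and these
become Volterra operators in the time domain. If `H` is rational with limit `L` at infinity, then
`H = L + K` with `K` strictly proper; expanding the entries of `K` in powers of `1/s` exhibits them
as transforms of entire functions, so that `H` acts on continuous signals on `[0, T]` as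
`u ↦ L u + K * u` (`HasLimit.represents`). Everything is computed modulo terms which are
`O(exp (-σ s))` for all `σ < T`. Rational matrices respect this congruence since they grow
polynomially, and a continuous signal is determined on `[0, T]` by its class: this is a theorem on
real Laplace transforms, proved by Mikusiński's series (`integral_eq_zero_of_negligible`).

Write `R = Y_d - G₂ D`. The law reads `U_{k+1} = (I - Γ G₁) U_k + Γ R`, and it generates continuous
inputs exactly if `Γ G₁` is proper and `Γ R` is a continuous signal (`continuousInputs_iff`).
Since all outputs are `C¹` with the same initial value, `s R` is a continuous signal, which makes
`Γ R = (Γ / s)(s R)` continuous when `Γ / s` is proper; ramps as trajectories show that this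
condition is necessary if all trajectories are to be admitted. As `s G₁` has a proper left inverse,
trackable trajectories are tracked by continuous inputs.

Let `L = lim Γ G₁`. If `ρ(I - L) < 1`, then `L` is invertible, so `(Γ G₁)⁻¹` is proper and
`(Γ G₁)⁻¹ Γ R` is the transform of a continuous fixed point `u_∞` of the law. The differences
`u_k - u_∞` satisfy `v ↦ (I - L) v + K * v`, and they decay uniformly in an exponentially weighted
norm adapted to `I - L` (`tendstoUniformlyOn_zero_of_recursion`). Conversely, convolutions vanish
at time `0`, so the difference of two runs starts with `(I - L)ᵏ v`; if all runs converge to the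
same limit, then `(I - L)ᵏ v → 0` for every `v` and hence `ρ(I - L) < 1`. That the limits agree is
automatic when `Γ G₁` is nonsingular, because the difference of two limits is annihilated by `Γ G₁`.
The statements on the limits are then computations with rational matrices together with the
uniqueness of signals.
-/

noncomputable section

namespace ILC

variable {T : ℝ} {a b c n q p m : ℕ}

/-! ### Evaluation of rational functions near infinity -/

theorem eventually_denom_ne_zero (r : RatFunc ℝ) :
    ∀ᶠ s : ℝ in atTop, r.denom.eval₂ (RingHom.id ℝ) s ≠ 0 := by
  filter_upwards [Polynomial.eventually_atTop_not_isRoot r.denom r.denom_ne_zero] with s hs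
  simpa [Polynomial.IsRoot.def, Polynomial.eval₂_id] using hs

theorem ev_eq_div (r : RatFunc ℝ) (s : ℝ) : ev r s = r.num.eval s / r.denom.eval s := by
  simp [ev, RatFunc.eval, Polynomial.eval₂_id]

theorem ev_add_eventually (r r' : RatFunc ℝ) :
    ∀ᶠ s : ℝ in atTop, ev (r + r') s = ev r s + ev r' s := by
  filter_upwards [eventually_denom_ne_zero r, eventually_denom_ne_zero r'] with s h h'
  exact RatFunc.eval_add _ _ h h'

theorem ev_mul_eventually (r r' : RatFunc ℝ) :
    ∀ᶠ s : ℝ in atTop, ev (r * r') s = ev r s * ev r' s := by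
  filter_upwards [eventually_denom_ne_zero r, eventually_denom_ne_zero r'] with s h h'
  exact RatFunc.eval_mul _ _ h h'

@[simp] theorem ev_zero (s : ℝ) : ev 0 s = 0 := RatFunc.eval_zero _ _
@[simp] theorem ev_one (s : ℝ) : ev 1 s = 1 := RatFunc.eval_one _ _
@[simp] theorem ev_C (c s : ℝ) : ev (RatFunc.C c) s = c := RatFunc.eval_C _ _
@[simp] theorem ev_X (s : ℝ) : ev RatFunc.X s = s := RatFunc.eval_X _ _

theorem ev_sum_eventually {ι : Type*} (t : Finset ι) (r : ι → RatFunc ℝ) :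
    ∀ᶠ s : ℝ in atTop, ev (∑ i ∈ t, r i) s = ∑ i ∈ t, ev (r i) s := by
  classical
  induction t using Finset.induction_on with
  | empty => simp
  | insert a t ha ih =>
    filter_upwards [ih, ev_add_eventually (r a) (∑ i ∈ t, r i)] with s h1 h2
    rw [Finset.sum_insert ha, Finset.sum_insert ha, h2, h1]

theorem ev_ne_zero_eventually {r : RatFunc ℝ} (hr : r ≠ 0) :
    ∀ᶠ s : ℝ in atTop, ev r s ≠ 0 := by
  filter_upwards [ev_mul_eventually r r⁻¹] with s hs h
  rw [mul_inv_cancel₀ hr, h, ev_one, zero_mul] at hs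
  exact one_ne_zero hs

theorem ev_inv_X_eventually : ∀ᶠ s : ℝ in atTop, ev (RatFunc.X)⁻¹ s = s⁻¹ := by
  filter_upwards [ev_mul_eventually RatFunc.X (RatFunc.X)⁻¹] with s hs
  rw [mul_inv_cancel₀ RatFunc.X_ne_zero, ev_one, ev_X] at hs
  exact (inv_eq_of_mul_eq_one_right hs.symm).symm

/-- Polynomial growth is what allows rational functions to act on transforms modulo negligible
terms. -/
theorem ev_isBigO_pow (r : RatFunc ℝ) : ∃ n : ℕ, ev r =O[atTop] fun s : ℝ => s ^ n := by
  refine ⟨r.num.natDegree, ?_⟩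
  have h : r.num.degree ≤ (r.denom * Polynomial.X ^ r.num.natDegree).degree := by
    rw [Polynomial.degree_mul, Polynomial.degree_X_pow]
    have h1 : (0 : WithBot ℕ) ≤ r.denom.degree :=
      Polynomial.zero_le_degree_iff.2 r.denom_ne_zero
    calc r.num.degree ≤ (r.num.natDegree : WithBot ℕ) := Polynomial.degree_le_natDegree
      _ ≤ _ := le_add_of_nonneg_left h1
  have h2 := (Polynomial.isBigO_atTop_of_degree_le _ _ h).mul
    (isBigO_refl (fun s : ℝ => (r.denom.eval s)⁻¹) atTop)
  refine (h2.congr' (Eventually.of_forall fun s => ?_) ?_)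
  · exact (ev_eq_div r s).symm
  · filter_upwards [eventually_denom_ne_zero r] with s hs
    rw [Polynomial.eval₂_id] at hs
    simp only [Polynomial.eval_mul, Polynomial.eval_pow, Polynomial.eval_X]
    field_simp

/-- A rational function that stays bounded near infinity has a limit there. -/
theorem ev_tendsto_of_isBigO_one {r : RatFunc ℝ}
    (h : ev r =O[atTop] fun _ : ℝ => (1 : ℝ)) : ∃ c, Tendsto (ev r) atTop (𝓝 c) := by
  have e : ev r = fun s => r.num.eval s / r.denom.eval s := funext (ev_eq_div r)
  rw [e] at h ⊢
  rcases lt_trichotomy r.num.degree r.denom.degree with hd | hd | hd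
  · exact ⟨_, Polynomial.div_tendsto_atTop_zero_of_degree_lt _ _ hd⟩
  · exact ⟨_, Polynomial.div_tendsto_atTop_leadingCoeff_div_of_degree_eq _ _ hd⟩
  · exfalso
    have h1 := Polynomial.abs_div_tendsto_atTop_atTop_of_degree_gt _ _ hd r.denom_ne_zero
    obtain ⟨C, hC⟩ := h.bound
    obtain ⟨s, hs, hs'⟩ := (hC.and (h1.eventually_gt_atTop C)).exists
    simp only [Real.norm_eq_abs, abs_one, mul_one] at hs
    linarith

/-! ### Evaluation of rational matrices near infinity -/

theorem evM_mul_eventually (A : RatMat a b) (B : RatMat b c) :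
    ∀ᶠ s : ℝ in atTop, evM (A * B) s = evM A s * evM B s := by
  have h1 : ∀ᶠ s : ℝ in atTop, ∀ i j,
      ev (∑ k, A i k * B k j) s = ∑ k, ev (A i k * B k j) s :=
    eventually_all.2 fun i => eventually_all.2 fun j => ev_sum_eventually _ _
  have h2 : ∀ᶠ s : ℝ in atTop, ∀ i j k, ev (A i k * B k j) s = ev (A i k) s * ev (B k j) s :=
    eventually_all.2 fun i => eventually_all.2 fun j => eventually_all.2 fun k =>
      ev_mul_eventually _ _
  filter_upwards [h1, h2] with s h1 h2
  ext i j
  simp [evM, Matrix.mul_apply, h1, h2]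

theorem evM_add_eventually (A B : RatMat a b) :
    ∀ᶠ s : ℝ in atTop, evM (A + B) s = evM A s + evM B s := by
  have h1 : ∀ᶠ s : ℝ in atTop, ∀ i j, ev (A i j + B i j) s = ev (A i j) s + ev (B i j) s :=
    eventually_all.2 fun i => eventually_all.2 fun j => ev_add_eventually _ _
  filter_upwards [h1] with s h1
  ext i j
  simp [evM, h1]

theorem evM_sub_eventually (A B : RatMat a b) :
    ∀ᶠ s : ℝ in atTop, evM (A - B) s = evM A s - evM B s := by
  filter_upwards [evM_add_eventually (A - B) B] with s h
  rw [sub_add_cancel] at h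
  rw [h, add_sub_cancel_right]

theorem evM_smul_eventually (r : RatFunc ℝ) (A : RatMat a b) :
    ∀ᶠ s : ℝ in atTop, evM (r • A) s = ev r s • evM A s := by
  have h1 : ∀ᶠ s : ℝ in atTop, ∀ i j, ev (r * A i j) s = ev r s * ev (A i j) s :=
    eventually_all.2 fun i => eventually_all.2 fun j => ev_mul_eventually _ _
  filter_upwards [h1] with s h1
  ext i j
  simp [evM, h1]

@[simp] theorem evM_one (s : ℝ) : evM (1 : RatMat n n) s = 1 := by
  ext i j
  by_cases h : i = j <;> simp [evM, Matrix.one_apply, h]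

/-- The constant rational matrix with value `L`. -/
def constM (L : Matrix (Fin a) (Fin b) ℝ) : RatMat a b := L.map RatFunc.C

@[simp] theorem evM_constM (L : Matrix (Fin a) (Fin b) ℝ) (s : ℝ) : evM (constM L) s = L := by
  ext i j; simp [evM, constM]

theorem hasLimit_constM (L : Matrix (Fin a) (Fin b) ℝ) : HasLimit (constM L) L := by
  simp [HasLimit]

theorem hasLimit_iff {A : RatMat a b} {L : Matrix (Fin a) (Fin b) ℝ} :
    HasLimit A L ↔ ∀ i j, Tendsto (ev (A i j)) atTop (𝓝 (L i j)) := by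
  rw [HasLimit]
  exact tendsto_pi_nhds.trans (forall_congr' fun i => tendsto_pi_nhds)

theorem HasLimit.mul {A : RatMat a b} {B : RatMat b c} {L : Matrix (Fin a) (Fin b) ℝ}
    {M : Matrix (Fin b) (Fin c) ℝ} (hA : HasLimit A L) (hB : HasLimit B M) :
    HasLimit (A * B) (L * M) := by
  refine hasLimit_iff.2 fun i j => ?_
  have h : Tendsto (fun s => ∑ k, ev (A i k) s * ev (B k j) s) atTop (𝓝 ((L * M) i j)) :=
    tendsto_finsetSum _ fun k _ => (hasLimit_iff.1 hA i k).mul (hasLimit_iff.1 hB k j)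
  refine h.congr' ?_
  filter_upwards [evM_mul_eventually A B] with s hs
  simpa [evM, Matrix.mul_apply] using (congrFun (congrFun hs i) j).symm

theorem HasLimit.sub {A B : RatMat a b} {L M : Matrix (Fin a) (Fin b) ℝ}
    (hA : HasLimit A L) (hB : HasLimit B M) : HasLimit (A - B) (L - M) :=
  (Tendsto.sub hA hB).congr' ((evM_sub_eventually A B).mono fun _ hs => hs.symm)

theorem hasLimit_one : HasLimit (1 : RatMat n n) 1 := by
  simp [HasLimit]

theorem HasLimit.transpose {A : RatMat a b} {L : Matrix (Fin a) (Fin b) ℝ}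
    (hA : HasLimit A L) : HasLimit Aᵀ Lᵀ :=
  hasLimit_iff.2 fun i j => hasLimit_iff.1 hA j i

theorem proper_of_isBigO {A : RatMat a b}
    (h : ∀ i j, ev (A i j) =O[atTop] fun _ : ℝ => (1 : ℝ)) : Proper A := by
  choose L hL using fun i j => ev_tendsto_of_isBigO_one (h i j)
  exact ⟨Matrix.of L, hasLimit_iff.2 hL⟩

theorem properAfterIntegration_iff {A : RatMat a b} :
    ProperAfterIntegration A ↔ Proper ((RatFunc.X : RatFunc ℝ)⁻¹ • A) := by
  refine exists_congr fun L => tendsto_congr' ?_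
  filter_upwards [evM_smul_eventually (RatFunc.X)⁻¹ A, ev_inv_X_eventually] with s h1 h2
  rw [h1, h2]

/-- A square rational matrix which is invertible at arbitrarily large points is nonsingular. -/
theorem det_ne_zero_of_frequently {A : RatMat n n}
    (h : ∃ᶠ s : ℝ in atTop, (evM A s).det ≠ 0) : A.det ≠ 0 := by
  intro h0
  obtain ⟨v, hv, hAv⟩ := Matrix.exists_mulVec_eq_zero_iff.2 h0
  obtain ⟨j, hj⟩ := Function.ne_iff.1 hv
  have h1 : A * Matrix.replicateCol (Fin 1) v = 0 := by
    ext i k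
    simpa [Matrix.mul_apply, Matrix.mulVec, dotProduct] using congrFun hAv i
  have h2 := evM_mul_eventually A (Matrix.replicateCol (Fin 1) v)
  obtain ⟨s, hs, hs2, hs3⟩ := (h.and_eventually (h2.and (ev_ne_zero_eventually hj))).exists
  rw [h1] at hs2
  have h3 : evM A s *ᵥ (fun i => ev (v i) s) = 0 := by
    ext i
    have := congrFun (congrFun hs2 i) 0
    simpa [evM, Matrix.mul_apply, Matrix.mulVec, dotProduct] using this.symm
  exact hs3 (congrFun (Matrix.eq_zero_of_mulVec_eq_zero hs h3) j)

theorem evM_inv_mul_eventually {A : RatMat n n} (hA : A.det ≠ 0) :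
    ∀ᶠ s : ℝ in atTop, evM A⁻¹ s * evM A s = 1 := by
  filter_upwards [evM_mul_eventually A⁻¹ A] with s hs
  rw [← hs, Matrix.nonsing_inv_mul _ (isUnit_iff_ne_zero.2 hA), evM_one]

theorem HasLimit.det_ne_zero {A : RatMat n n} {L : Matrix (Fin n) (Fin n) ℝ}
    (hA : HasLimit A L) (hL : L.det ≠ 0) : A.det ≠ 0 := by
  have h : Tendsto (fun s => (evM A s).det) atTop (𝓝 L.det) :=
    ((continuous_id.matrix_det).tendsto L).comp hA
  exact det_ne_zero_of_frequently (h.eventually_ne hL).frequently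

theorem HasLimit.inv {A : RatMat n n} {L : Matrix (Fin n) (Fin n) ℝ}
    (hA : HasLimit A L) (hL : L.det ≠ 0) : HasLimit A⁻¹ L⁻¹ := by
  have h : Tendsto (fun s => (evM A s).det) atTop (𝓝 L.det) :=
    ((continuous_id.matrix_det).tendsto L).comp hA
  have h' : Tendsto (fun s => (evM A s).adjugate) atTop (𝓝 L.adjugate) :=
    ((continuous_id.matrix_adjugate).tendsto L).comp hA
  have h2 := (h.inv₀ hL).smul h'
  have h3 : L⁻¹ = L.det⁻¹ • L.adjugate := by rw [Matrix.inv_def, Ring.inverse_eq_inv']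
  unfold HasLimit
  rw [h3]
  refine h2.congr' ?_
  filter_upwards [evM_inv_mul_eventually (hA.det_ne_zero hL)] with s hs
  rw [← Matrix.inv_eq_left_inv hs, Matrix.inv_def, Ring.inverse_eq_inv']

/-! ### Scalar Laplace transforms on `[0, T]` -/

/-- The Laplace transform (at real `s`) of a scalar signal on `[0, T]`. -/
def lap (T : ℝ) (f : ℝ → ℝ) (s : ℝ) : ℝ := ∫ t in (0 : ℝ)..T, Real.exp (-(s * t)) * f t

/-- `F(s)` is invisible on `[0, T]`: it is `O(exp (-σ s))` as `s → ∞` for every `σ < T`. -/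
def Negligible (T : ℝ) (F : ℝ → ℝ) : Prop :=
  ∀ σ < T, F =O[atTop] fun s : ℝ => Real.exp (-(σ * s))

theorem Negligible.zero : Negligible T fun _ => 0 := fun _ _ => isBigO_zero _ _

theorem Negligible.add {F H : ℝ → ℝ} (hF : Negligible T F) (hH : Negligible T H) :
    Negligible T fun s => F s + H s := fun σ hσ => (hF σ hσ).add (hH σ hσ)

theorem Negligible.neg {F : ℝ → ℝ} (hF : Negligible T F) :
    Negligible T fun s => -F s := fun σ hσ => (hF σ hσ).neg_left

theorem Negligible.sub {F H : ℝ → ℝ} (hF : Negligible T F) (hH : Negligible T H) :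
    Negligible T fun s => F s - H s := fun σ hσ => (hF σ hσ).sub (hH σ hσ)

theorem Negligible.congr' {F H : ℝ → ℝ} (hF : Negligible T F) (h : F =ᶠ[atTop] H) :
    Negligible T H := fun σ hσ => (hF σ hσ).congr' h EventuallyEq.rfl

theorem Negligible.sum {ι : Type*} (t : Finset ι) {F : ι → ℝ → ℝ}
    (hF : ∀ i ∈ t, Negligible T (F i)) : Negligible T fun s => ∑ i ∈ t, F i s :=
  fun σ hσ => by
    simpa only [Finset.sum_apply] using (IsBigO.sum fun i hi => hF i hi σ hσ).congr_left fun s =>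
      Finset.sum_apply s t F

/-- Polynomial growth is absorbed by the exponential bounds. -/
theorem Negligible.pow_mul {F : ℝ → ℝ} (hF : Negligible T F) {g : ℝ → ℝ} {n : ℕ}
    (hg : g =O[atTop] fun s : ℝ => s ^ n) : Negligible T fun s => g s * F s := by
  intro σ hσ
  obtain ⟨σ', h1, h2⟩ := exists_between hσ
  refine (hg.mul (hF σ' h2)).trans ?_
  have h3 : (fun s : ℝ => s ^ n) =O[atTop] fun s => Real.exp ((σ' - σ) * s) :=
    (isLittleO_pow_exp_pos_mul_atTop n (sub_pos.2 h1)).isBigO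
  refine (h3.mul (isBigO_refl (fun s : ℝ => Real.exp (-(σ' * s))) atTop)).congr_right fun s => ?_
  rw [← Real.exp_add]
  ring_nf

theorem Negligible.ev_mul {F : ℝ → ℝ} (hF : Negligible T F) (r : RatFunc ℝ) :
    Negligible T fun s => ev r s * F s := by
  obtain ⟨n, hn⟩ := ev_isBigO_pow r
  exact hF.pow_mul hn

/-- Anything that is `O(exp (-T s))` is negligible on `[0, T]`. -/
theorem Negligible.of_isBigO {F : ℝ → ℝ}
    (hF : F =O[atTop] fun s : ℝ => Real.exp (-(T * s))) : Negligible T F := by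
  intro σ hσ
  refine hF.trans (IsBigO.of_bound 1 ?_)
  filter_upwards [eventually_ge_atTop 0] with s hs
  rw [one_mul, Real.norm_eq_abs, Real.norm_eq_abs, Real.abs_exp, Real.abs_exp, Real.exp_le_exp]
  nlinarith

theorem lap_congr {f g : ℝ → ℝ} (hT : 0 ≤ T) (h : EqOn f g (Icc 0 T)) : lap T f = lap T g := by
  ext s
  refine intervalIntegral.integral_congr fun t ht => ?_
  rw [uIcc_of_le hT] at ht
  simp only [h ht]

theorem intervalIntegrable_exp_mul {f : ℝ → ℝ} {a b : ℝ}
    (hf : IntervalIntegrable f volume a b) (s : ℝ) :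
    IntervalIntegrable (fun t => Real.exp (-(s * t)) * f t) volume a b :=
  hf.continuousOn_mul (by fun_prop)

theorem lap_sub {f g : ℝ → ℝ} (hf : IntervalIntegrable f volume 0 T)
    (hg : IntervalIntegrable g volume 0 T) (s : ℝ) :
    lap T (fun t => f t - g t) s = lap T f s - lap T g s := by
  simp only [lap, mul_sub]
  exact intervalIntegral.integral_sub (intervalIntegrable_exp_mul hf s)
    (intervalIntegrable_exp_mul hg s)

theorem lap_add {f g : ℝ → ℝ} (hf : IntervalIntegrable f volume 0 T)
    (hg : IntervalIntegrable g volume 0 T) (s : ℝ) :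
    lap T (fun t => f t + g t) s = lap T f s + lap T g s := by
  simp only [lap, mul_add]
  exact intervalIntegral.integral_add (intervalIntegrable_exp_mul hf s)
    (intervalIntegrable_exp_mul hg s)

theorem lap_const_mul (c : ℝ) (f : ℝ → ℝ) (s : ℝ) :
    lap T (fun t => c * f t) s = c * lap T f s := by
  simp only [lap, ← intervalIntegral.integral_const_mul]
  congr 1; ext t; ring

theorem lap_sum {ι : Type*} (t : Finset ι) {f : ι → ℝ → ℝ}
    (hf : ∀ i ∈ t, IntervalIntegrable (f i) volume 0 T) (s : ℝ) :
    lap T (fun x => ∑ i ∈ t, f i x) s = ∑ i ∈ t, lap T (f i) s := by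
  simp only [lap, Finset.mul_sum]
  exact intervalIntegral.integral_finsetSum fun i hi => intervalIntegrable_exp_mul (hf i hi) s

theorem abs_lap_le {f : ℝ → ℝ} (hT : 0 ≤ T) {C s : ℝ} (hs : 0 < s)
    (hC : ∀ t ∈ Icc 0 T, |f t| ≤ C) : |lap T f s| ≤ C / s := by
  have hC0 : 0 ≤ C := (abs_nonneg _).trans (hC 0 ⟨le_rfl, hT⟩)
  have h1 : ∀ t, HasDerivAt (fun t => -(C / s) * Real.exp (-(s * t)))
      (C * Real.exp (-(s * t))) t := fun t => by
    have h := (((hasDerivAt_id t).const_mul s).neg.exp).const_mul (-(C / s))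
    refine h.congr_deriv ?_
    simp only [id, Pi.neg_apply]
    field_simp
  have h2 : ∫ t in (0 : ℝ)..T, C * Real.exp (-(s * t)) = C / s * (1 - Real.exp (-(s * T))) := by
    rw [intervalIntegral.integral_eq_sub_of_hasDerivAt (fun t _ => h1 t)
      ((by fun_prop : Continuous fun t => C * Real.exp (-(s * t))).intervalIntegrable _ _)]
    simp; ring
  have h3 : |lap T f s| ≤ ∫ t in (0 : ℝ)..T, C * Real.exp (-(s * t)) := by
    rw [← Real.norm_eq_abs]
    refine intervalIntegral.norm_integral_le_of_norm_le hT (ae_of_all _ fun t ht => ?_)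
      ((by fun_prop : Continuous fun t => C * Real.exp (-(s * t))).intervalIntegrable _ _)
    rw [norm_mul, Real.norm_eq_abs, Real.abs_exp, mul_comm]
    exact mul_le_mul_of_nonneg_right (hC t ⟨ht.1.le, ht.2⟩) (Real.exp_pos _).le
  refine h3.trans (h2.le.trans ?_)
  exact mul_le_of_le_one_right (by positivity) (by linarith [Real.exp_pos (-(s * T))])

/-! ### Uniqueness of signals with a given transform -/

/-- Mikusiński's argument: the sums `∑ (-1)ᵏ / k! · exp (k s y) · 𝓛f(k s)` equal
`∫ exp (-exp (s (y - t))) f(t) dt`, and the weight `exp (-exp (s (y - t)))` tends to the indicator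
of `t > y` as `s → ∞`, whereas all terms with `k ≥ 1` die out by hypothesis. -/
theorem integral_eq_zero_of_negligible {f : ℝ → ℝ} (hf : IntervalIntegrable f volume 0 T)
    (h : Negligible T (lap T f)) {y : ℝ} (hy : y ∈ Ioo 0 T) : ∫ t in (0 : ℝ)..y, f t = 0 := by
  have hT : 0 < T := hy.1.trans hy.2
  obtain ⟨σ, hyσ, hσT⟩ := exists_between hy.2
  have hσ0 : 0 < σ := hy.1.trans hyσ
  obtain ⟨C, hC⟩ := (h σ hσT).bound
  obtain ⟨s₀, hs₀⟩ := eventually_atTop.1 hC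
  let W : ℝ → ℝ → ℝ := fun s t => Real.exp (-Real.exp (s * (y - t)))
  have hWc : ∀ s, Continuous (W s) := fun s => by fun_prop
  -- The exponential series, integrated termwise.
  have hsum : ∀ s : ℝ, 0 ≤ s →
      HasSum (fun k : ℕ => (-1) ^ k / k.factorial * Real.exp (k * s * y) * lap T f (k * s))
        (∫ t in (0 : ℝ)..T, W s t * f t) := by
    intro s hs
    have key := intervalIntegral.hasSum_integral_of_dominated_convergence (μ := volume)
      (a := 0) (b := T) (ι := ℕ)
      (F := fun k t => ((-1) ^ k / k.factorial * Real.exp (k * s * y)) *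
        (Real.exp (-(k * s * t)) * f t))
      (f := fun t => W s t * f t)
      (fun k t => (Real.exp (s * y)) ^ k / k.factorial * |f t|)
      (fun k => (intervalIntegrable_iff.1
        ((intervalIntegrable_exp_mul hf (k * s)).const_mul _)).aestronglyMeasurable)
      (fun k => ae_of_all _ fun t ht => ?_)
      (ae_of_all _ fun t _ => (Real.summable_pow_div_factorial _).mul_right _)
      ?_ (ae_of_all _ fun t _ => ?_)
    · simpa only [intervalIntegral.integral_const_mul, lap] using key
    · rw [uIoc_of_le hT.le] at ht
      have h1 : Real.exp (-(k * s * t)) ≤ 1 := by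
        rw [Real.exp_le_one_iff]
        have := ht.1.le
        have : 0 ≤ k * s * t := by positivity
        linarith
      rw [norm_mul, norm_mul, norm_mul, norm_div, norm_pow, norm_neg, norm_one, one_pow,
        Real.norm_eq_abs (Real.exp _), Real.norm_eq_abs (Real.exp _), Real.abs_exp, Real.abs_exp,
        ← Real.exp_nat_mul, Real.norm_eq_abs (f t), Real.norm_natCast, ← mul_assoc (k : ℝ)]
      have h2 : 0 ≤ 1 / (k.factorial : ℝ) * Real.exp (k * s * y) * |f t| := by positivity
      calc _ = 1 / (k.factorial : ℝ) * Real.exp (k * s * y) * |f t| * Real.exp (-(k * s * t)) := by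
            ring
        _ ≤ 1 / (k.factorial : ℝ) * Real.exp (k * s * y) * |f t| * 1 := by gcongr
        _ = _ := by ring
    · simp only [tsum_mul_right]
      exact hf.abs.const_mul _
    · have := (NormedSpace.expSeries_div_hasSum_exp (-Real.exp (s * (y - t)))).mul_right (f t)
      rw [← Real.exp_eq_exp_ℝ] at this
      refine this.congr_fun fun k => ?_
      have e : Real.exp (k * s * y) * Real.exp (-(k * s * t)) = Real.exp (s * (y - t)) ^ k := by
        rw [← Real.exp_add, ← Real.exp_nat_mul]
        congr 1; ring
      rw [neg_pow (Real.exp _), ← e]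
      ring
  have htail : Tendsto (fun s => (∫ t in (0 : ℝ)..T, W s t * f t) - ∫ t in (0 : ℝ)..T, f t)
      atTop (𝓝 0) := by
    have hb : ∀ s, max s₀ 1 ≤ s → |(∫ t in (0 : ℝ)..T, W s t * f t) - ∫ t in (0 : ℝ)..T, f t| ≤
        C * (Real.exp (Real.exp (s * (y - σ))) - 1) := by
      intro s hs
      have hs1 : 1 ≤ s := (le_max_right _ _).trans hs
      have hs0 : s₀ ≤ s := (le_max_left _ _).trans hs
      have h1 := (hasSum_nat_add_iff' 1).2 (hsum s (by linarith))
      have h2 : HasSum (fun k : ℕ => C * (Real.exp (s * (y - σ)) ^ (k + 1) / (k + 1).factorial))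
          (C * (Real.exp (Real.exp (s * (y - σ))) - 1)) := by
        have := NormedSpace.expSeries_div_hasSum_exp (Real.exp (s * (y - σ)))
        rw [← Real.exp_eq_exp_ℝ] at this
        have := ((hasSum_nat_add_iff' 1).2 this).mul_left C
        simpa using this
      have h3 := h1.norm_le_of_bounded h2 fun k => ?_
      · simpa [lap] using h3
      · have hks : s₀ ≤ ((k + 1 : ℕ) : ℝ) * s := by
          push_cast
          nlinarith [Nat.cast_nonneg (α := ℝ) k]
        have h4 := hs₀ _ hks
        rw [Real.norm_eq_abs (Real.exp _), Real.abs_exp] at h4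
        rw [norm_mul, norm_mul, norm_div, norm_pow, norm_neg, norm_one, one_pow,
          Real.norm_eq_abs (Real.exp _), Real.abs_exp, Real.norm_natCast]
        calc _ ≤ 1 / ((k + 1).factorial : ℝ) * Real.exp ((k + 1 : ℕ) * s * y) *
              (C * Real.exp (-(σ * ((k + 1 : ℕ) * s)))) := by gcongr
          _ = C * ((Real.exp ((k + 1 : ℕ) * s * y) * Real.exp (-(σ * ((k + 1 : ℕ) * s)))) /
              (k + 1).factorial) := by ring
          _ = _ := by
            rw [← Real.exp_add, ← Real.exp_nat_mul]
            congr 3; ring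
    have hlim : Tendsto (fun s => C * (Real.exp (Real.exp (s * (y - σ))) - 1)) atTop (𝓝 0) := by
      have h1 : Tendsto (fun s : ℝ => s * (y - σ)) atTop atBot :=
        tendsto_id.atTop_mul_const_of_neg (by linarith)
      have h2 := (Real.continuous_exp.tendsto 0).comp (Real.tendsto_exp_atBot.comp h1)
      have h3 := (h2.sub_const 1).const_mul C
      simpa using h3
    refine squeeze_zero_norm' ?_ hlim
    filter_upwards [eventually_ge_atTop (max s₀ 1)] with s hs using hb s hs
  have hf1 : IntervalIntegrable f volume 0 y :=
    hf.mono_set (by rw [uIcc_of_le hy.1.le, uIcc_of_le hT.le]; exact Icc_subset_Icc_right hy.2.le)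
  have hf2 : IntervalIntegrable f volume y T :=
    hf.mono_set (by rw [uIcc_of_le hy.2.le, uIcc_of_le hT.le]; exact Icc_subset_Icc_left hy.1.le)
  have hW1 : ∀ s t, |W s t * f t| ≤ |f t| := fun s t => by
    rw [abs_mul, Real.abs_exp]
    exact mul_le_of_le_one_left (abs_nonneg _) (Real.exp_le_one_iff.2 (by
      have := Real.exp_pos (s * (y - t)); linarith))
  have hne : ∀ᵐ t : ℝ, t ≠ y := by simp [ae_iff]
  have hlow : Tendsto (fun s => ∫ t in (0 : ℝ)..y, W s t * f t) atTop
      (𝓝 (∫ t in (0 : ℝ)..y, (0 : ℝ))) := by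
    refine intervalIntegral.tendsto_integral_filter_of_dominated_convergence (fun t => |f t|)
      (Eventually.of_forall fun s =>
        (intervalIntegrable_iff.1
          (hf1.continuousOn_mul (hWc s).continuousOn)).aestronglyMeasurable)
      (Eventually.of_forall fun s => ae_of_all _ fun t _ => hW1 s t) hf1.abs ?_
    filter_upwards [hne] with t ht htm
    rw [uIoc_of_le hy.1.le] at htm
    have hty : 0 < y - t := sub_pos.2 (lt_of_le_of_ne htm.2 ht)
    have h1 : Tendsto (fun s : ℝ => s * (y - t)) atTop atTop := tendsto_id.atTop_mul_const hty
    have h2 := (Real.tendsto_exp_neg_atTop_nhds_zero.comp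
      (Real.tendsto_exp_atTop.comp h1)).mul_const (f t)
    simpa using h2
  have hhigh : Tendsto (fun s => ∫ t in y..T, W s t * f t) atTop (𝓝 (∫ t in y..T, f t)) := by
    refine intervalIntegral.tendsto_integral_filter_of_dominated_convergence (fun t => |f t|)
      (Eventually.of_forall fun s =>
        (intervalIntegrable_iff.1
          (hf2.continuousOn_mul (hWc s).continuousOn)).aestronglyMeasurable)
      (Eventually.of_forall fun s => ae_of_all _ fun t _ => hW1 s t) hf2.abs ?_
    refine ae_of_all _ fun t htm => ?_
    rw [uIoc_of_le hy.2.le] at htm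
    have h1 : Tendsto (fun s : ℝ => s * (y - t)) atTop atBot :=
      tendsto_id.atTop_mul_const_of_neg (by linarith [htm.1])
    have h2 := ((Real.continuous_exp.tendsto _).comp
      (Real.tendsto_exp_atBot.comp h1).neg).mul_const (f t)
    simpa using h2
  have hlim2 := (hlow.add hhigh).sub_const (∫ t in (0 : ℝ)..T, f t)
  have heq : ∀ s, (∫ t in (0 : ℝ)..y, W s t * f t) + (∫ t in y..T, W s t * f t) =
      ∫ t in (0 : ℝ)..T, W s t * f t := fun s =>
    intervalIntegral.integral_add_adjacent_intervals
      (hf1.continuousOn_mul (hWc s).continuousOn) (hf2.continuousOn_mul (hWc s).continuousOn)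
  simp only [heq] at hlim2
  have := tendsto_nhds_unique hlim2 htail
  rw [← intervalIntegral.integral_add_adjacent_intervals hf1 hf2] at this
  simp at this
  linarith

/-- A function continuous on `[0, T]` extends to a continuous function on the line. -/
theorem exists_continuous_extension {E : Type*} [TopologicalSpace E] {f : ℝ → E} (hT : 0 ≤ T)
    (hf : ContinuousOn f (Icc 0 T)) : ∃ g : ℝ → E, Continuous g ∧ EqOn f g (Icc 0 T) :=
  ⟨IccExtend hT ((Icc 0 T).domRestrict f),
    (continuousOn_iff_continuous_domRestrict.1 hf).Icc_extend',
    fun t ht => by rw [IccExtend_of_mem _ _ ht]; rfl⟩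

/-- A continuous signal with negligible transform vanishes: all its primitives do. -/
theorem eqOn_zero_of_negligible {f : ℝ → ℝ} (hT : 0 < T) (hf : ContinuousOn f (Icc 0 T))
    (h : Negligible T (lap T f)) : EqOn f 0 (Icc 0 T) := by
  obtain ⟨g, hg, hfg⟩ := exists_continuous_extension hT.le hf
  rw [lap_congr hT.le hfg] at h
  have h0 : EqOn g 0 (Ioo 0 T) := by
    intro t ht
    have h1 : HasDerivAt (fun y => ∫ t in (0 : ℝ)..y, g t) (g t) t :=
      (hg.integral_hasStrictDerivAt 0 t).hasDerivAt
    have h2 : (fun y => ∫ t in (0 : ℝ)..y, g t) =ᶠ[𝓝 t] fun _ => 0 := by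
      filter_upwards [Ioo_mem_nhds ht.1 ht.2] with y hy
      exact integral_eq_zero_of_negligible (hg.intervalIntegrable _ _) h hy
    exact h1.unique ((hasDerivAt_const t (0 : ℝ)).congr_of_eventuallyEq h2)
  have h1 : EqOn g 0 (Icc 0 T) := by
    rw [← closure_Ioo hT.ne]
    exact h0.closure hg continuous_const
  exact fun t ht => (hfg ht).trans (h1 ht)

/-! ### Integration by parts -/

/-- `s 𝓛w = c + 𝓛v` for `w = c + ∫ v`, up to the boundary term at `T`. -/
theorem lap_primitive {v : ℝ → ℝ} (hv : Continuous v) (c : ℝ) :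
    Negligible T fun s => s * lap T (fun t => c + ∫ τ in (0 : ℝ)..t, v τ) s - (c + lap T v s) := by
  set w : ℝ → ℝ := fun t => c + ∫ τ in (0 : ℝ)..t, v τ with hw
  have hw' : ∀ t, HasDerivAt w (v t) t := fun t =>
    (hv.integral_hasStrictDerivAt 0 t).hasDerivAt.const_add c
  have key : ∀ s, s * lap T w s - (c + lap T v s) = -(Real.exp (-(T * s)) * w T) := by
    intro s
    have h1 : ∀ t, HasDerivAt (fun t => -Real.exp (-(s * t))) (s * Real.exp (-(s * t))) t :=
      fun t => by
        have h := (((hasDerivAt_id t).const_mul s).neg.exp).neg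
        refine h.congr_deriv ?_
        simp only [id, Pi.neg_apply]
        ring
    have h2 := intervalIntegral.integral_mul_deriv_eq_deriv_mul (a := 0) (b := T)
      (fun t _ => hw' t) (fun t _ => h1 t) (hv.intervalIntegrable _ _)
      ((by fun_prop : Continuous fun t => s * Real.exp (-(s * t))).intervalIntegrable _ _)
    have h3 : s * lap T w s = ∫ t in (0 : ℝ)..T, w t * (s * Real.exp (-(s * t))) := by
      rw [lap, ← intervalIntegral.integral_const_mul]
      congr 1; ext t; ring
    have h4 : ∫ t in (0 : ℝ)..T, v t * -Real.exp (-(s * t)) = -lap T v s := by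
      rw [lap, ← intervalIntegral.integral_neg]
      congr 1; ext t; ring
    have h5 : w 0 = c := by simp [hw]
    rw [h3, h2, h4, h5, mul_comm T s]
    simp
    ring
  simp only [key]
  refine (Negligible.of_isBigO ?_).neg
  exact ((isBigO_refl (fun s => Real.exp (-(T * s))) atTop).mul
    (isBigO_const_const (w T) (one_ne_zero (α := ℝ)) atTop)).congr_right fun s => mul_one _

/-! ### Inverse Laplace transforms of strictly proper rational functions -/

/-- The expansion of a strictly proper rational function at infinity. It comes from the Taylor
series at `0` of the function `x ↦ r(1/x) / x`, which is a quotient of polynomials in `x`. -/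
theorem exists_expansion_at_infinity {r : RatFunc ℝ} (hr : Tendsto (ev r) atTop (𝓝 0)) :
    ∃ (h : ℕ → ℝ) (C a : ℝ), 0 < C ∧ 0 < a ∧ (∀ k, |h k| ≤ C * a ^ k) ∧
      ∀ᶠ s : ℝ in atTop, HasSum (fun k => h k * s⁻¹ ^ (k + 1)) (ev r s) := by
  have e : ev r = fun s => r.num.eval s / r.denom.eval s := funext (ev_eq_div r)
  have hdeg : r.num.degree < r.denom.degree := by
    rw [e] at hr
    exact (Polynomial.div_tendsto_atTop_zero_iff_degree_lt _ _ r.denom_ne_zero).1 hr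
  set N := r.denom.natDegree with hN
  have hnumN : r.num.natDegree ≤ N := Polynomial.natDegree_le_natDegree hdeg.le
  set P := Polynomial.reflect N r.num with hP
  set Q := Polynomial.reflect N r.denom with hQ
  have hQ0 : Q.eval 0 ≠ 0 := by
    rw [← Polynomial.coeff_zero_eq_eval_zero, hQ, Polynomial.coeff_reflect,
      Polynomial.revAt_le (Nat.zero_le _), Nat.sub_zero, hN, Polynomial.coeff_natDegree,
      (RatFunc.monic_denom r).leadingCoeff]
    exact one_ne_zero
  have hP0 : P.coeff 0 = 0 := by
    rw [hP, Polynomial.coeff_reflect, Polynomial.revAt_le (Nat.zero_le _), Nat.sub_zero]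
    exact Polynomial.coeff_eq_zero_of_degree_lt
      (hdeg.trans_le Polynomial.degree_le_natDegree)
  have hPX : P = P.divX * Polynomial.X := by
    conv_lhs => rw [← Polynomial.divX_mul_X_add P, hP0, map_zero, add_zero]
  have hF : AnalyticAt ℝ (fun x : ℝ => P.divX.eval x / Q.eval x) 0 :=
    ((AnalyticOnNhd.eval_polynomial P.divX) 0 (mem_univ _)).div
      ((AnalyticOnNhd.eval_polynomial Q) 0 (mem_univ _)) hQ0
  obtain ⟨p, hp⟩ := hF
  obtain ⟨ρ, hρ0, hρ⟩ := ENNReal.lt_iff_exists_nnreal_btwn.1 hp.radius_pos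
  have hρ0' : 0 < ρ := by exact_mod_cast hρ0
  obtain ⟨C, hC, hb⟩ := p.norm_le_div_pow_of_pos_of_lt_radius hρ0' hρ
  refine ⟨p.coeff, C, (ρ : ℝ)⁻¹, hC, by positivity, fun k => ?_, ?_⟩
  · have := hb k
    rw [FormalMultilinearSeries.norm_apply_eq_norm_coef, Real.norm_eq_abs] at this
    rwa [inv_pow, ← div_eq_mul_inv]
  · have h1 := tendsto_inv_atTop_zero.eventually (hasFPowerSeriesAt_iff.1 hp)
    filter_upwards [h1, eventually_denom_ne_zero r, eventually_gt_atTop 0] with s hs hden hs0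
    rw [Polynomial.eval₂_id] at hden
    have : Invertible s := invertibleOfNonzero hs0.ne'
    have hnum := Polynomial.eval₂_reflect_mul_pow (RingHom.id ℝ) s N r.num hnumN
    have hdn := Polynomial.eval₂_reflect_mul_pow (RingHom.id ℝ) s N r.denom le_rfl
    rw [Polynomial.eval₂_id, Polynomial.eval₂_id, invOf_eq_inv] at hnum hdn
    rw [← hP, hPX, Polynomial.eval_mul, Polynomial.eval_X] at hnum
    rw [← hQ] at hdn
    have hval : ev r s = s⁻¹ * (P.divX.eval s⁻¹ / Q.eval s⁻¹) := by
      have hQs : Q.eval s⁻¹ ≠ 0 := fun h => hden (by rw [← hdn, h, zero_mul])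
      rw [ev_eq_div, ← hnum, ← hdn]
      field_simp
    rw [zero_add] at hs
    rw [hval]
    refine (hs.mul_left s⁻¹).congr_fun fun k => ?_
    rw [smul_eq_mul, pow_succ]
    ring

theorem integral_pow_mul_exp_neg {s : ℝ} (hs : 0 < s) (k : ℕ) :
    ∫ t in Ioi (0 : ℝ), Real.exp (-(s * t)) * (t ^ k / k.factorial) = s⁻¹ ^ (k + 1) := by
  have h := Real.integral_rpow_mul_exp_neg_mul_Ioi (a := k + 1) (r := s) (by positivity) hs
  rw [Real.Gamma_nat_eq_factorial, one_div] at h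
  have h2 : ∀ t : ℝ, Real.exp (-(s * t)) * (t ^ k / k.factorial) =
      (t ^ ((k : ℝ) + 1 - 1) * Real.exp (-(s * t))) * (k.factorial : ℝ)⁻¹ := fun t => by
    rw [add_sub_cancel_right, Real.rpow_natCast]; ring
  simp only [h2, integral_mul_const]
  rw [h, show ((k : ℝ) + 1) = ((k + 1 : ℕ) : ℝ) by push_cast; ring, Real.rpow_natCast]
  have : (k.factorial : ℝ) ≠ 0 := by positivity
  field_simp

theorem integrableOn_pow_mul_exp_neg {s : ℝ} (hs : 0 < s) (k : ℕ) :
    IntegrableOn (fun t : ℝ => Real.exp (-(s * t)) * (t ^ k / k.factorial)) (Ioi 0) := by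
  refine Integrable.of_integral_ne_zero ?_
  rw [integral_pow_mul_exp_neg hs]
  positivity

/-- A strictly proper `r = ∑ hₖ s⁻ᵏ⁻¹` is the transform of the entire function
`∑ hₖ tᵏ / k!`. -/
theorem exists_isInvLaplace {r : RatFunc ℝ} (hr : Tendsto (ev r) atTop (𝓝 0)) :
    ∃ φ, IsInvLaplace φ r := by
  obtain ⟨h, C, a, hC, ha, hb, hsum⟩ := exists_expansion_at_infinity hr
  have hterm : ∀ (t : ℝ) k, ‖h k * (t ^ k / k.factorial)‖ ≤
      C * ((a * |t|) ^ k / k.factorial) := fun t k => by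
    rw [norm_mul, Real.norm_eq_abs, norm_div, norm_pow, Real.norm_eq_abs t, Real.norm_natCast]
    calc _ ≤ C * a ^ k * (|t| ^ k / k.factorial) := by gcongr; exact hb k
      _ = _ := by rw [mul_pow]; ring
  have hexp : ∀ x : ℝ, HasSum (fun k : ℕ => C * (x ^ k / k.factorial)) (C * Real.exp x) :=
    fun x => by
      have := NormedSpace.expSeries_div_hasSum_exp x
      rw [← Real.exp_eq_exp_ℝ] at this
      exact this.mul_left C
  have hφs : ∀ t : ℝ, Summable fun k => h k * (t ^ k / k.factorial) := fun t =>
    (hexp (a * |t|)).summable.of_norm_bounded (hterm t)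
  set φ : ℝ → ℝ := fun t => ∑' k, h k * (t ^ k / k.factorial) with hφ
  have hφb : ∀ t, 0 ≤ t → ‖φ t‖ ≤ C * Real.exp (a * t) := fun t ht =>
    tsum_of_norm_bounded (hexp (a * t)) fun k => by
      have := hterm t k
      rwa [abs_of_nonneg ht] at this
  have hφc : Continuous φ := by
    refine continuous_iff_continuousAt.2 fun t₀ => ?_
    have h1 : ContinuousOn φ (Ioo (-(|t₀| + 1)) (|t₀| + 1)) :=
      continuousOn_tsum (fun k => by fun_prop) (hexp (a * (|t₀| + 1))).summable fun k t ht => by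
        refine (hterm t k).trans ?_
        have : |t| ≤ |t₀| + 1 := (abs_lt.2 ht).le
        gcongr
    exact h1.continuousAt
      (Ioo_mem_nhds (by linarith [neg_abs_le t₀]) (by linarith [le_abs_self t₀]))
  refine ⟨φ, hφc.continuousOn, ?_⟩
  filter_upwards [hsum, eventually_gt_atTop a] with s hs has
  have hs0 : 0 < s := ha.trans has
  have hint : ∀ k : ℕ, IntegrableOn
      (fun t : ℝ => Real.exp (-(s * t)) * (h k * (t ^ k / k.factorial))) (Ioi 0) := fun k => by
    refine ((integrableOn_pow_mul_exp_neg hs0 k).const_mul (h k)).congr (ae_of_all _ fun t => ?_)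
    ring
  have hval : ∀ k : ℕ, ∫ t in Ioi (0 : ℝ), Real.exp (-(s * t)) * (h k * (t ^ k / k.factorial)) =
      h k * s⁻¹ ^ (k + 1) := fun k => by
    rw [← integral_pow_mul_exp_neg hs0 k, ← integral_const_mul]
    congr 1; ext t; ring
  have hnorm : ∀ k : ℕ, ∫ t in Ioi (0 : ℝ),
      ‖Real.exp (-(s * t)) * (h k * (t ^ k / k.factorial))‖ = |h k| * s⁻¹ ^ (k + 1) := fun k => by
    rw [← integral_pow_mul_exp_neg hs0 k, ← integral_const_mul]
    refine setIntegral_congr_fun measurableSet_Ioi fun t ht => ?_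
    have ht' : (0 : ℝ) < t := ht
    simp only [norm_mul, norm_div, norm_pow, Real.norm_eq_abs, Real.abs_exp, abs_of_pos ht',
      Nat.abs_cast]
    ring
  have hsm : Summable fun k : ℕ => |h k| * s⁻¹ ^ (k + 1) := by
    have hg : Summable fun k : ℕ => C * s⁻¹ * (a * s⁻¹) ^ k :=
      (summable_geometric_of_lt_one (by positivity)
        (by rw [← div_eq_mul_inv, div_lt_one hs0]; exact has)).mul_left _
    refine hg.of_nonneg_of_le (fun k => by positivity) fun k => ?_
    calc _ ≤ C * a ^ k * s⁻¹ ^ (k + 1) := by gcongr; exact hb k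
      _ = _ := by rw [mul_pow, pow_succ]; ring
  have key := hasSum_integral_of_summable_integral_norm hint (by simpa only [hnorm] using hsm)
  simp only [hval, tsum_mul_left] at key
  refine ⟨?_, key.unique hs⟩
  have hdom : IntegrableOn (fun t : ℝ => C * Real.exp (-(s - a) * t)) (Ioi 0) :=
    (exp_neg_integrableOn_Ioi 0 (sub_pos.2 has)).const_mul C
  refine Integrable.mono' hdom
    ((by fun_prop : Continuous fun t => Real.exp (-(s * t)) * φ t).aestronglyMeasurable) ?_
  refine (ae_restrict_iff' measurableSet_Ioi).2 (ae_of_all _ fun t ht => ?_)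
  rw [norm_mul, Real.norm_eq_abs, Real.abs_exp]
  calc _ ≤ Real.exp (-(s * t)) * (C * Real.exp (a * t)) := by
        gcongr; exact hφb t (le_of_lt ht)
    _ = C * (Real.exp (-(s * t)) * Real.exp (a * t)) := by ring
    _ = _ := by rw [← Real.exp_add]; congr 2; ring

/-- The part of a Laplace transform contributed by times after `T` is negligible on `[0, T]`. -/
theorem negligible_tail (hT : 0 ≤ T) {f : ℝ → ℝ}
    (hf : ∀ᶠ s : ℝ in atTop, IntegrableOn (fun t : ℝ => Real.exp (-(s * t)) * f t) (Ioi 0)) :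
    Negligible T fun s => (∫ t in Ioi (0 : ℝ), Real.exp (-(s * t)) * f t) - lap T f s := by
  obtain ⟨s₀, hs₀⟩ := eventually_atTop.1 hf
  refine Negligible.of_isBigO (IsBigO.of_bound
    (Real.exp (s₀ * T) * ∫ t in Ioi T, ‖Real.exp (-(s₀ * t)) * f t‖) ?_)
  filter_upwards [eventually_ge_atTop s₀] with s hs
  have hsub : Ioi T ⊆ Ioi (0 : ℝ) := Ioi_subset_Ioi hT
  have h1 := intervalIntegral.integral_interval_add_Ioi (hs₀ s hs) ((hs₀ s hs).mono_set hsub)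
  have h2 : (∫ t in Ioi (0 : ℝ), Real.exp (-(s * t)) * f t) - lap T f s =
      ∫ t in Ioi T, Real.exp (-(s * t)) * f t := by rw [← h1, lap]; ring
  rw [h2, Real.norm_eq_abs (Real.exp _), Real.abs_exp]
  have h3 : ∀ t ∈ Ioi T, ‖Real.exp (-(s * t)) * f t‖ ≤
      Real.exp (-((s - s₀) * T)) * ‖Real.exp (-(s₀ * t)) * f t‖ := fun t ht => by
    have e : Real.exp (-(s * t)) = Real.exp (-((s - s₀) * t)) * Real.exp (-(s₀ * t)) := by
      rw [← Real.exp_add]; congr 1; ring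
    rw [e, mul_assoc, norm_mul, Real.norm_eq_abs (Real.exp _), Real.abs_exp]
    gcongr
    have := sub_nonneg.2 hs
    have ht' : T < t := ht
    nlinarith
  have h4 := norm_integral_le_of_norm_le (((hs₀ s₀ le_rfl).mono_set hsub).norm.const_mul
    (Real.exp (-((s - s₀) * T)))) ((ae_restrict_iff' measurableSet_Ioi).2 (ae_of_all _ h3))
  rw [integral_const_mul] at h4
  refine h4.trans (le_of_eq ?_)
  have e : Real.exp (-((s - s₀) * T)) = Real.exp (s₀ * T) * Real.exp (-(T * s)) := by
    rw [← Real.exp_add]; congr 1; ring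
  rw [e]; ring

theorem IsInvLaplace.negligible {φ : ℝ → ℝ} {r : RatFunc ℝ} (h : IsInvLaplace φ r)
    (hT : 0 ≤ T) : Negligible T fun s => ev r s - lap T φ s :=
  (negligible_tail hT (h.2.mono fun _ hs => hs.1)).congr'
    (h.2.mono fun s hs => by simp only [hs.2])

/-- The convolution theorem for a rational transfer function and a signal on `[0, T]`. -/
theorem IsInvLaplace.negligible_convolution {φ : ℝ → ℝ} {r : RatFunc ℝ} (h : IsInvLaplace φ r)
    (hT : 0 ≤ T) {u : ℝ → ℝ} (hu : ContinuousOn u (Icc 0 T)) :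
    Negligible T fun s =>
      ev r s * lap T u s - lap T (fun t => ∫ τ in (0 : ℝ)..t, φ (t - τ) * u τ) s := by
  -- The signal is cut off at `T`, so that its transform over `(0, ∞)` is `lap T u`.
  set u' : ℝ → ℝ := indicator (Iic T) u with hu'
  set H : ℝ → ℝ := fun t => ∫ τ in (0 : ℝ)..t, φ (t - τ) * u' τ with hH
  have hlap : lap T (fun t => ∫ τ in (0 : ℝ)..t, φ (t - τ) * u τ) = lap T H := by
    refine lap_congr hT fun t ht => intervalIntegral.integral_congr fun τ hτ => ?_
    rw [uIcc_of_le ht.1] at hτ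
    simp only [hu', indicator_of_mem (show τ ∈ Iic T from hτ.2.trans ht.2)]
  have hI : Ioi 0 ∩ Iic T = Ioc 0 T := Ioi_inter_Iic
  have hint : ∀ s : ℝ, IntegrableOn (fun t => Real.exp (-(s * t)) * u' t) (Ioi 0) := fun s => by
    have h1 : (fun t => Real.exp (-(s * t)) * u' t) =
        indicator (Iic T) fun t => Real.exp (-(s * t)) * u t := by
      ext t
      by_cases ht : t ∈ Iic T <;> simp [hu', ht]
    rw [h1, IntegrableOn, integrable_indicator_iff measurableSet_Iic, IntegrableOn,
      Measure.restrict_restrict measurableSet_Iic, inter_comm, hI]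
    exact ((ContinuousOn.mul (by fun_prop) hu).integrableOn_Icc).mono_set Ioc_subset_Icc_self
  have hval : ∀ s : ℝ, ∫ t in Ioi (0 : ℝ), Real.exp (-(s * t)) * u' t = lap T u s := fun s => by
    have h1 : (fun t => Real.exp (-(s * t)) * u' t) =
        indicator (Iic T) fun t => Real.exp (-(s * t)) * u t := by
      ext t
      by_cases ht : t ∈ Iic T <;> simp [hu', ht]
    rw [h1, setIntegral_indicator measurableSet_Iic, hI, lap,
      intervalIntegral.integral_of_le hT]
  have hinner : ∀ s x : ℝ, ∫ t in (0 : ℝ)..x, ContinuousLinearMap.mul ℝ ℝ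
      (Real.exp (-(s * t)) * u' t) (Real.exp (-(s * (x - t))) * φ (x - t)) =
      Real.exp (-(s * x)) * H x := fun s x => by
    rw [hH, ← intervalIntegral.integral_const_mul]
    congr 1; ext t
    have e : Real.exp (-(s * x)) = Real.exp (-(s * t)) * Real.exp (-(s * (x - t))) := by
      rw [← Real.exp_add]; congr 1; ring
    rw [ContinuousLinearMap.mul_apply', e]
    ring
  have key : ∀ᶠ s : ℝ in atTop, IntegrableOn (fun t => Real.exp (-(s * t)) * H t) (Ioi 0) ∧
      ∫ t in Ioi (0 : ℝ), Real.exp (-(s * t)) * H t = ev r s * lap T u s := by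
    filter_upwards [h.2] with s hs
    constructor
    · have := integrable_posConvolution (hint s) hs.1 (ContinuousLinearMap.mul ℝ ℝ)
      unfold posConvolution at this
      rw [integrable_indicator_iff measurableSet_Ioi] at this
      simpa only [hinner] using this
    · have := integral_posConvolution (hint s) hs.1 (ContinuousLinearMap.mul ℝ ℝ)
      simp only [hinner] at this
      rw [this, hs.2, hval, ContinuousLinearMap.mul_apply', mul_comm]
  rw [hlap]
  exact (negligible_tail hT (key.mono fun _ hs => hs.1)).congr'
    (key.mono fun s hs => by simp only [hs.2])

theorem isInvLaplace_invLaplace {r : RatFunc ℝ} (hr : Tendsto (ev r) atTop (𝓝 0)) :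
    IsInvLaplace (invLaplace r) r := by
  have h := exists_isInvLaplace hr
  rw [invLaplace, dif_pos h]
  exact h.choose_spec

/-! ### Vector signals on `[0, T]` -/

theorem eqUpTo_iff {F H : ℝ → Fin n → ℝ} :
    EqUpTo T F H ↔ ∀ i, Negligible T fun s => F s i - H s i :=
  ⟨fun h i σ hσ => isBigO_pi.1 (h σ hσ) i, fun h σ hσ => isBigO_pi.2 fun i => h i σ hσ⟩

theorem EqUpTo.refl (F : ℝ → Fin n → ℝ) : EqUpTo T F F :=
  eqUpTo_iff.2 fun i => by simpa using Negligible.zero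

theorem EqUpTo.symm {F H : ℝ → Fin n → ℝ} (h : EqUpTo T F H) : EqUpTo T H F :=
  eqUpTo_iff.2 fun i => by simpa using (eqUpTo_iff.1 h i).neg

theorem EqUpTo.trans {F G H : ℝ → Fin n → ℝ} (h : EqUpTo T F G) (h' : EqUpTo T G H) :
    EqUpTo T F H :=
  eqUpTo_iff.2 fun i => by simpa using (eqUpTo_iff.1 h i).add (eqUpTo_iff.1 h' i)

theorem EqUpTo.add {F F' H H' : ℝ → Fin n → ℝ} (h : EqUpTo T F H) (h' : EqUpTo T F' H') :
    EqUpTo T (fun s => F s + F' s) fun s => H s + H' s :=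
  eqUpTo_iff.2 fun i => by
    simpa only [Pi.add_apply, add_sub_add_comm] using
      (eqUpTo_iff.1 h i).add (eqUpTo_iff.1 h' i)

theorem EqUpTo.sub {F F' H H' : ℝ → Fin n → ℝ} (h : EqUpTo T F H) (h' : EqUpTo T F' H') :
    EqUpTo T (fun s => F s - F' s) fun s => H s - H' s :=
  eqUpTo_iff.2 fun i => by
    simpa only [Pi.sub_apply, sub_sub_sub_comm] using
      (eqUpTo_iff.1 h i).sub (eqUpTo_iff.1 h' i)

theorem EqUpTo.of_eventuallyEq {F H : ℝ → Fin n → ℝ} (h : F =ᶠ[atTop] H) : EqUpTo T F H :=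
  eqUpTo_iff.2 fun _ => Negligible.zero.congr' (h.mono fun s (hs : F s = H s) => by simp [hs])

/-- Rational matrices act on signals modulo terms that are invisible on `[0, T]`. -/
theorem EqUpTo.mulVec {F H : ℝ → Fin b → ℝ} (h : EqUpTo T F H) (A : RatMat a b) :
    EqUpTo T (fun s => evM A s *ᵥ F s) fun s => evM A s *ᵥ H s :=
  eqUpTo_iff.2 fun i => by
    refine (Negligible.sum Finset.univ fun j _ => (eqUpTo_iff.1 h j).ev_mul (A i j)).congr'
      (Eventually.of_forall fun s => ?_)
    simp [Matrix.mulVec, dotProduct, evM, mul_sub]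

theorem EqUpTo.smul {F H : ℝ → Fin n → ℝ} (h : EqUpTo T F H) {g : ℝ → ℝ} {k : ℕ}
    (hg : g =O[atTop] fun s : ℝ => s ^ k) : EqUpTo T (fun s => g s • F s) fun s => g s • H s :=
  eqUpTo_iff.2 fun i => by
    simpa only [Pi.smul_apply, smul_eq_mul, mul_sub] using (eqUpTo_iff.1 h i).pow_mul hg

theorem EqUpTo.of_smul {F H : ℝ → Fin n → ℝ}
    (h : EqUpTo T (fun s => s • F s) fun s => s • H s) : EqUpTo T F H := by
  have h1 : (fun s : ℝ => s⁻¹) =O[atTop] fun s : ℝ => s ^ 0 := by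
    simpa using (tendsto_inv_atTop_zero (𝕜 := ℝ)).isBigO_one ℝ
  have h2 : ∀ F : ℝ → Fin n → ℝ, F =ᶠ[atTop] fun s => s⁻¹ • s • F s := fun F => by
    filter_upwards [eventually_ne_atTop 0] with s hs
    rw [inv_smul_smul₀ hs]
  exact (EqUpTo.of_eventuallyEq (h2 F)).trans
    ((h.smul h1).trans (EqUpTo.of_eventuallyEq (h2 H).symm))

theorem intervalIntegrable_of_continuousOn_Icc {E : Type*} [NormedAddCommGroup E] {f : ℝ → E}
    (hT : 0 ≤ T) (hf : ContinuousOn f (Icc 0 T)) : IntervalIntegrable f volume 0 T :=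
  ContinuousOn.intervalIntegrable (by rwa [uIcc_of_le hT])

theorem integral_apply_of_intervalIntegrable {f : ℝ → Fin n → ℝ} {x y : ℝ}
    (hf : IntervalIntegrable f volume x y) (i : Fin n) :
    (∫ t in x..y, f t) i = ∫ t in x..y, f t i :=
  ((ContinuousLinearMap.proj (R := ℝ) (φ := fun _ : Fin n => ℝ) i).intervalIntegral_comp_comm
    hf).symm

theorem laplace_apply {f : ℝ → Fin n → ℝ} (hT : 0 ≤ T) (hf : ContinuousOn f (Icc 0 T)) (s : ℝ)
    (i : Fin n) : laplace T f s i = lap T (fun t => f t i) s := by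
  rw [laplace, integral_apply_of_intervalIntegrable]
  · rfl
  · exact intervalIntegrable_of_continuousOn_Icc hT
      (ContinuousOn.smul (f := fun t => Real.exp (-(s * t))) (by fun_prop) hf)

theorem intervalIntegrable_apply {f : ℝ → Fin n → ℝ} (hT : 0 ≤ T)
    (hf : ContinuousOn f (Icc 0 T)) (i : Fin n) :
    IntervalIntegrable (fun t => f t i) volume 0 T :=
  intervalIntegrable_of_continuousOn_Icc hT ((continuous_apply i).comp_continuousOn hf)

theorem laplace_congr {f g : ℝ → Fin n → ℝ} (hT : 0 ≤ T) (h : EqOn f g (Icc 0 T)) :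
    laplace T f = laplace T g := by
  ext1 s
  refine intervalIntegral.integral_congr fun t ht => ?_
  rw [uIcc_of_le hT] at ht
  simp only [h ht]

theorem laplace_sub {f g : ℝ → Fin n → ℝ} (hT : 0 ≤ T) (hf : ContinuousOn f (Icc 0 T))
    (hg : ContinuousOn g (Icc 0 T)) (s : ℝ) :
    laplace T (fun t => f t - g t) s = laplace T f s - laplace T g s := by
  ext i
  rw [Pi.sub_apply, laplace_apply hT hf, laplace_apply hT hg,
    laplace_apply (f := fun t => f t - g t) hT (hf.sub hg)]
  exact lap_sub (intervalIntegrable_apply hT hf i) (intervalIntegrable_apply hT hg i) s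

theorem laplace_add {f g : ℝ → Fin n → ℝ} (hT : 0 ≤ T) (hf : ContinuousOn f (Icc 0 T))
    (hg : ContinuousOn g (Icc 0 T)) (s : ℝ) :
    laplace T (fun t => f t + g t) s = laplace T f s + laplace T g s := by
  ext i
  rw [Pi.add_apply, laplace_apply hT hf, laplace_apply hT hg,
    laplace_apply (f := fun t => f t + g t) hT (hf.add hg)]
  exact lap_add (intervalIntegrable_apply hT hf i) (intervalIntegrable_apply hT hg i) s

theorem continuousOn_mulVec {f : ℝ → Fin b → ℝ} {s : Set ℝ} (L : Matrix (Fin a) (Fin b) ℝ)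
    (hf : ContinuousOn f s) : ContinuousOn (fun t => L *ᵥ f t) s :=
  (continuous_const.matrix_mulVec continuous_id : Continuous fun v => L *ᵥ v).comp_continuousOn hf

theorem laplace_mulVec {f : ℝ → Fin b → ℝ} (hT : 0 ≤ T) (L : Matrix (Fin a) (Fin b) ℝ)
    (hf : ContinuousOn f (Icc 0 T)) (s : ℝ) :
    laplace T (fun t => L *ᵥ f t) s = L *ᵥ laplace T f s := by
  ext i
  rw [laplace_apply hT (continuousOn_mulVec L hf)]
  simp only [Matrix.mulVec, dotProduct]
  rw [lap_sum _ fun j _ => (intervalIntegrable_apply hT hf j).const_mul _]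
  simp only [lap_const_mul, laplace_apply hT hf]

theorem laplace_zero (s : ℝ) : laplace T (fun _ => (0 : Fin n → ℝ)) s = 0 := by
  simp [laplace]

/-- A continuous signal on `[0, T]` is determined by its transform. -/
theorem eqOn_of_eqUpTo {f g : ℝ → Fin n → ℝ} (hT : 0 < T) (hf : ContinuousOn f (Icc 0 T))
    (hg : ContinuousOn g (Icc 0 T)) (h : EqUpTo T (laplace T f) (laplace T g)) :
    EqOn f g (Icc 0 T) := by
  have h1 : ∀ i, EqOn (fun t => f t i - g t i) 0 (Icc 0 T) := fun i => by
    refine eqOn_zero_of_negligible hT (((continuous_apply i).comp_continuousOn hf).sub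
      ((continuous_apply i).comp_continuousOn hg)) ?_
    refine (eqUpTo_iff.1 h i).congr' (Eventually.of_forall fun s => ?_)
    beta_reduce
    rw [laplace_apply hT.le hf, laplace_apply hT.le hg,
      ← lap_sub (intervalIntegrable_apply hT.le hf i) (intervalIntegrable_apply hT.le hg i)]
  exact fun t ht => funext fun i => sub_eq_zero.1 (h1 i ht)

theorem Represents.eqOn {F : ℝ → Fin n → ℝ} {f g : ℝ → Fin n → ℝ} (hT : 0 < T)
    (hf : Represents T F f) (hg : Represents T F g) : EqOn f g (Icc 0 T) :=
  eqOn_of_eqUpTo hT hf.1 hg.1 (hf.2.symm.trans hg.2)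

theorem represents_laplace {f : ℝ → Fin n → ℝ} (hf : ContinuousOn f (Icc 0 T)) :
    Represents T (laplace T f) f := ⟨hf, EqUpTo.refl _⟩

theorem Represents.of_eqUpTo {F H : ℝ → Fin n → ℝ} {f : ℝ → Fin n → ℝ}
    (h : Represents T F f) (hH : EqUpTo T H F) : Represents T H f := ⟨h.1, hH.trans h.2⟩

theorem Represents.add {F H : ℝ → Fin n → ℝ} {f g : ℝ → Fin n → ℝ} (hT : 0 ≤ T)
    (hf : Represents T F f) (hg : Represents T H g) :
    Represents T (fun s => F s + H s) fun t => f t + g t :=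
  ⟨hf.1.add hg.1, (hf.2.add hg.2).trans
    (EqUpTo.of_eventuallyEq (Eventually.of_forall fun s => (laplace_add hT hf.1 hg.1 s).symm))⟩

theorem Represents.sub {F H : ℝ → Fin n → ℝ} {f g : ℝ → Fin n → ℝ} (hT : 0 ≤ T)
    (hf : Represents T F f) (hg : Represents T H g) :
    Represents T (fun s => F s - H s) fun t => f t - g t :=
  ⟨hf.1.sub hg.1, (hf.2.sub hg.2).trans
    (EqUpTo.of_eventuallyEq (Eventually.of_forall fun s => (laplace_sub hT hf.1 hg.1 s).symm))⟩

/-- The transform of a continuous signal is `O(1/s)`. -/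
theorem Represents.isBigO_inv {F : ℝ → Fin n → ℝ} {f : ℝ → Fin n → ℝ} (hT : 0 < T)
    (hf : Represents T F f) (i : Fin n) : (fun s => F s i) =O[atTop] fun s : ℝ => s⁻¹ := by
  have h1 : (fun s => F s i - laplace T f s i) =O[atTop] fun s : ℝ => s⁻¹ := by
    refine (eqUpTo_iff.1 hf.2 i (T / 2) (half_lt_self hT)).trans ?_
    have := (isLittleO_exp_neg_mul_rpow_atTop (half_pos hT) (-1)).isBigO
    refine this.congr' (Eventually.of_forall fun s => by ring_nf) ?_
    filter_upwards [eventually_gt_atTop 0] with s hs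
    rw [Real.rpow_neg_one]
  have h2 : (fun s => laplace T f s i) =O[atTop] fun s : ℝ => s⁻¹ := by
    obtain ⟨C, hC⟩ := isCompact_Icc.exists_bound_of_continuousOn
      ((continuous_apply i).comp_continuousOn hf.1)
    refine IsBigO.of_bound C ?_
    filter_upwards [eventually_gt_atTop 0] with s hs
    rw [laplace_apply hT.le hf.1, Real.norm_eq_abs, Real.norm_eq_abs, abs_of_pos (inv_pos.2 hs),
      ← div_eq_mul_inv]
    exact abs_lap_le hT.le hs hC
  simpa using h1.add h2

/-! ### Differentiable signals -/

/-- If `s F(s) = c + 𝓛v` with `v` continuous, then `F` is the transform of `c + ∫ v`. -/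
theorem exists_contDiff_of_smul_eqUpTo {F : ℝ → Fin n → ℝ} {c : Fin n → ℝ} {v : ℝ → Fin n → ℝ}
    (hT : 0 ≤ T) (hv : ContinuousOn v (Icc 0 T))
    (h : EqUpTo T (fun s => s • F s) fun s => c + laplace T v s) :
    ∃ w : ℝ → Fin n → ℝ, ContDiff ℝ 1 w ∧ w 0 = c ∧ Represents T F w := by
  obtain ⟨v', hv', hvv'⟩ := exists_continuous_extension hT hv
  rw [laplace_congr hT hvv'] at h
  have hw' : ∀ t, HasDerivAt (fun t => c + ∫ τ in (0 : ℝ)..t, v' τ) (v' t) t := fun t =>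
    (hv'.integral_hasStrictDerivAt 0 t).hasDerivAt.const_add c
  have hwd : ContDiff ℝ 1 fun t => c + ∫ τ in (0 : ℝ)..t, v' τ := by
    refine contDiff_one_iff_deriv.2 ⟨fun t => (hw' t).differentiableAt, ?_⟩
    rwa [show deriv (fun t => c + ∫ τ in (0 : ℝ)..t, v' τ) = v' from funext fun t => (hw' t).deriv]
  refine ⟨_, hwd, by simp, hwd.continuous.continuousOn, EqUpTo.of_smul (h.trans ?_)⟩
  refine EqUpTo.symm (eqUpTo_iff.2 fun i => ?_)
  refine (lap_primitive ((continuous_apply i).comp hv') (c i)).congr'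
    (Eventually.of_forall fun s => ?_)
  beta_reduce
  rw [Pi.add_apply, Pi.smul_apply, laplace_apply hT hwd.continuous.continuousOn,
    laplace_apply hT hv'.continuousOn]
  simp only [Pi.add_apply, integral_apply_of_intervalIntegrable (hv'.intervalIntegrable _ _)]
  rfl

/-- `s 𝓛f(s) = f(0) + 𝓛f'` for `f ∈ C¹[0, T]`. -/
theorem exists_smul_laplace_eqUpTo {f : ℝ → Fin n → ℝ} (hT : 0 < T)
    (hf : ContDiffOn ℝ 1 f (Icc 0 T)) :
    ∃ v : ℝ → Fin n → ℝ, ContinuousOn v (Icc 0 T) ∧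
      EqUpTo T (fun s => s • laplace T f s) fun s => f 0 + laplace T v s := by
  have hd : ContinuousOn (derivWithin f (Icc 0 T)) (Icc 0 T) :=
    hf.continuousOn_derivWithin (uniqueDiffOn_Icc hT) le_rfl
  obtain ⟨v, hv, hdv⟩ := exists_continuous_extension hT.le hd
  refine ⟨v, hv.continuousOn, ?_⟩
  have heq : EqOn f (fun t => f 0 + ∫ τ in (0 : ℝ)..t, v τ) (Icc 0 T) := by
    intro t ht
    have hsub : Icc 0 t ⊆ Icc 0 T := Icc_subset_Icc_right ht.2
    have := intervalIntegral.integral_eq_sub_of_hasDeriv_right_of_le ht.1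
      (hf.continuousOn.mono hsub) (f' := v) (fun x hx => ?_) (hv.intervalIntegrable _ _)
    · simp only [this, add_sub_cancel]
    · have hx' : x ∈ Ioo 0 T := ⟨hx.1, hx.2.trans_le ht.2⟩
      have h1 := (hf.differentiableOn one_ne_zero x (Ioo_subset_Icc_self hx')).hasDerivWithinAt
      rw [hdv (Ioo_subset_Icc_self hx')] at h1
      exact (h1.hasDerivAt (Icc_mem_nhds hx'.1 hx'.2)).hasDerivWithinAt
  have hwc : Continuous fun t => f 0 + ∫ τ in (0 : ℝ)..t, v τ :=
    continuous_const.add (intervalIntegral.continuous_primitive (fun _ _ =>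
      hv.intervalIntegrable _ _) 0)
  rw [laplace_congr hT.le heq]
  refine eqUpTo_iff.2 fun i => ?_
  refine (lap_primitive ((continuous_apply i).comp hv) (f 0 i)).congr'
    (Eventually.of_forall fun s => ?_)
  beta_reduce
  rw [Pi.add_apply, Pi.smul_apply, laplace_apply hT.le hwc.continuousOn,
    laplace_apply hT.le hv.continuousOn]
  simp only [Pi.add_apply, integral_apply_of_intervalIntegrable (hv.intervalIntegrable _ _)]
  rfl

/-! ### Proper rational matrices as convolution operators -/

/-- The matrix of inverse Laplace transforms of the entries of a rational matrix. -/
def kernel (H : RatMat a b) (t : ℝ) : Matrix (Fin a) (Fin b) ℝ :=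
  Matrix.of fun i j => invLaplace (H i j) t

/-- The convolution `∫₀ᵗ K(t - τ) u(τ) dτ` of a matrix kernel with a signal. -/
def conv (K : ℝ → Matrix (Fin a) (Fin b) ℝ) (u : ℝ → Fin b → ℝ) (t : ℝ) : Fin a → ℝ :=
  ∫ τ in (0 : ℝ)..t, K (t - τ) *ᵥ u τ

theorem StrictlyProper.isInvLaplace {H : RatMat a b} (hH : StrictlyProper H) (i : Fin a)
    (j : Fin b) : IsInvLaplace (invLaplace (H i j)) (H i j) :=
  isInvLaplace_invLaplace (hasLimit_iff.1 hH i j)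

theorem StrictlyProper.continuousOn_kernel {H : RatMat a b} (hH : StrictlyProper H) :
    ContinuousOn (kernel H) (Ici 0) :=
  continuousOn_pi.2 fun i => continuousOn_pi.2 fun j => (hH.isInvLaplace i j).1

theorem continuous_conv_integrand {K : ℝ → Matrix (Fin a) (Fin b) ℝ} {u : ℝ → Fin b → ℝ}
    (hK : Continuous K) (hu : Continuous u) :
    Continuous fun p : ℝ × ℝ => K (p.1 - p.2) *ᵥ u p.2 :=
  (hK.comp (continuous_fst.sub continuous_snd)).matrix_mulVec (hu.comp continuous_snd)

/-- On `[0, T]`, a convolution with data continuous on `[0, ∞)` and on `[0, T]` only agrees with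
a convolution of functions continuous on the line. -/
theorem exists_continuous_conv_eqOn {K : ℝ → Matrix (Fin a) (Fin b) ℝ} {u : ℝ → Fin b → ℝ}
    (hT : 0 ≤ T) (hK : ContinuousOn K (Ici 0)) (hu : ContinuousOn u (Icc 0 T)) :
    ∃ K' u', Continuous K' ∧ Continuous u' ∧ EqOn K K' (Ici 0) ∧ EqOn u u' (Icc 0 T) ∧
      ∀ t ∈ Icc 0 T, ∀ τ ∈ Icc 0 t, K (t - τ) *ᵥ u τ = K' (t - τ) *ᵥ u' τ := by
  obtain ⟨u', hu', huu'⟩ := exists_continuous_extension hT hu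
  have hKK' : EqOn K (fun t => K (max t 0)) (Ici 0) := fun t ht => by
    simp only [max_eq_left (show (0 : ℝ) ≤ t from ht)]
  refine ⟨fun t => K (max t 0), u', ?_, hu', hKK', huu', fun t ht τ hτ => ?_⟩
  · exact hK.comp_continuous (by fun_prop) fun t => show (0 : ℝ) ≤ max t 0 from le_max_right _ _
  · rw [hKK' (show (0 : ℝ) ≤ t - τ from sub_nonneg.2 hτ.2), huu' ⟨hτ.1, hτ.2.trans ht.2⟩]

theorem conv_eqOn {K K' : ℝ → Matrix (Fin a) (Fin b) ℝ} {u u' : ℝ → Fin b → ℝ}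
    (h : ∀ t ∈ Icc 0 T, ∀ τ ∈ Icc 0 t, K (t - τ) *ᵥ u τ = K' (t - τ) *ᵥ u' τ) :
    EqOn (conv K u) (conv K' u') (Icc 0 T) := fun t ht =>
  intervalIntegral.integral_congr fun τ hτ => h t ht τ (by rwa [uIcc_of_le ht.1] at hτ)

theorem continuousOn_conv {K : ℝ → Matrix (Fin a) (Fin b) ℝ} {u : ℝ → Fin b → ℝ}
    (hT : 0 ≤ T) (hK : ContinuousOn K (Ici 0)) (hu : ContinuousOn u (Icc 0 T)) :
    ContinuousOn (conv K u) (Icc 0 T) := by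
  obtain ⟨K', u', hK', hu', -, -, h⟩ := exists_continuous_conv_eqOn hT hK hu
  have hc : Continuous (conv K' u') :=
    intervalIntegral.continuous_parametric_intervalIntegral_of_continuous
      (f := fun t τ => K' (t - τ) *ᵥ u' τ) (continuous_conv_integrand hK' hu') continuous_id
  exact hc.continuousOn.congr (conv_eqOn h)

theorem intervalIntegrable_conv {K : ℝ → Matrix (Fin a) (Fin b) ℝ} {u : ℝ → Fin b → ℝ}
    (hT : 0 ≤ T) (hK : ContinuousOn K (Ici 0)) (hu : ContinuousOn u (Icc 0 T)) {t : ℝ}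
    (ht : t ∈ Icc 0 T) : IntervalIntegrable (fun τ => K (t - τ) *ᵥ u τ) volume 0 t := by
  obtain ⟨K', u', hK', hu', -, -, h⟩ := exists_continuous_conv_eqOn hT hK hu
  refine intervalIntegrable_of_continuousOn_Icc ht.1 (ContinuousOn.congr (f := fun τ =>
    K' (t - τ) *ᵥ u' τ) ?_ fun τ hτ => h t ht τ hτ)
  exact ((continuous_conv_integrand hK' hu').comp (continuous_const.prodMk continuous_id)
    ).continuousOn

theorem conv_sub {K : ℝ → Matrix (Fin a) (Fin b) ℝ} {u v : ℝ → Fin b → ℝ}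
    (hT : 0 ≤ T) (hK : ContinuousOn K (Ici 0)) (hu : ContinuousOn u (Icc 0 T))
    (hv : ContinuousOn v (Icc 0 T)) {t : ℝ} (ht : t ∈ Icc 0 T) :
    conv K (fun τ => u τ - v τ) t = conv K u t - conv K v t := by
  simp only [conv, Matrix.mulVec_sub]
  exact intervalIntegral.integral_sub (intervalIntegrable_conv hT hK hu ht)
    (intervalIntegrable_conv hT hK hv ht)

theorem norm_mulVec_le {M : Matrix (Fin a) (Fin b) ℝ} {κ : ℝ} (hκ : 0 ≤ κ)
    (hM : ∀ i j, |M i j| ≤ κ) (v : Fin b → ℝ) : ‖M *ᵥ v‖ ≤ b * κ * ‖v‖ := by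
  refine (pi_norm_le_iff_of_nonneg (by positivity)).2 fun i => ?_
  calc ‖(M *ᵥ v) i‖ ≤ ∑ j, ‖M i j * v j‖ := norm_sum_le Finset.univ fun j => M i j * v j
    _ ≤ ∑ _j : Fin b, κ * ‖v‖ := Finset.sum_le_sum fun j _ => by
        rw [norm_mul]
        exact mul_le_mul (hM i j) (norm_le_pi_norm v j) (norm_nonneg _) hκ
    _ = b * κ * ‖v‖ := by simp [mul_assoc]

/-- The Volterra estimate for a convolution operator. -/
theorem exists_norm_conv_le {K : ℝ → Matrix (Fin a) (Fin b) ℝ} (T : ℝ)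
    (hK : ContinuousOn K (Ici 0)) : ∃ κ, 0 ≤ κ ∧ ∀ u : ℝ → Fin b → ℝ, ContinuousOn u (Icc 0 T) →
      ∀ t ∈ Icc 0 T, ‖conv K u t‖ ≤ κ * ∫ τ in (0 : ℝ)..t, ‖u τ‖ := by
  have h1 : ∀ i j, ∃ C, ∀ t ∈ Icc 0 T, ‖K t i j‖ ≤ C := fun i j =>
    isCompact_Icc.exists_bound_of_continuousOn
      (continuousOn_pi.1 (continuousOn_pi.1 (hK.mono Icc_subset_Ici_self) i) j)
  choose C hC using h1
  have hκ : 0 ≤ ∑ i, ∑ j, |C i j| := by positivity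
  refine ⟨b * ∑ i, ∑ j, |C i j|, by positivity, fun u hu t ht => ?_⟩
  rw [conv, ← intervalIntegral.integral_const_mul]
  have hut : ContinuousOn u (Icc 0 t) := hu.mono (Icc_subset_Icc_right ht.2)
  refine intervalIntegral.norm_integral_le_of_norm_le ht.1 (ae_of_all _ fun τ hτ => ?_)
    ((intervalIntegrable_of_continuousOn_Icc ht.1 hut.norm).const_mul _)
  refine norm_mulVec_le hκ (fun i j => ?_) _
  calc |K (t - τ) i j| ≤ C i j := hC i j _ ⟨sub_nonneg.2 hτ.2, by linarith [hτ.1, ht.2]⟩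
    _ ≤ |C i j| := le_abs_self _
    _ ≤ ∑ j, |C i j| := Finset.single_le_sum (f := fun j => |C i j|)
        (fun _ _ => abs_nonneg _) (Finset.mem_univ j)
    _ ≤ _ := Finset.single_le_sum (f := fun i => ∑ j, |C i j|)
        (fun _ _ => Finset.sum_nonneg fun _ _ => abs_nonneg _) (Finset.mem_univ i)

/-- A strictly proper rational matrix acts on signals as the convolution with its kernel. -/
theorem StrictlyProper.represents_conv {H : RatMat a b} (hH : StrictlyProper H) (hT : 0 ≤ T)
    {u : ℝ → Fin b → ℝ} (hu : ContinuousOn u (Icc 0 T)) :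
    Represents T (fun s => evM H s *ᵥ laplace T u s) (conv (kernel H) u) := by
  have hc := continuousOn_conv hT hH.continuousOn_kernel hu
  refine ⟨hc, eqUpTo_iff.2 fun i => ?_⟩
  have hui : ∀ j, ContinuousOn (fun t => u t j) (Icc 0 T) := fun j =>
    (continuous_apply j).comp_continuousOn hu
  -- Each scalar convolution is continuous on `[0, T]`: replace kernel and signal by functions
  -- continuous on the line.
  have hs : ∀ j, ContinuousOn
      (fun t => ∫ τ in (0 : ℝ)..t, invLaplace (H i j) (t - τ) * u τ j) (Icc 0 T) ∧
      ∀ t ∈ Icc 0 T, IntervalIntegrable (fun τ => invLaplace (H i j) (t - τ) * u τ j)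
        volume 0 t := fun j => by
    obtain ⟨K', u', hK', hu', hKK', huu', -⟩ := exists_continuous_conv_eqOn hT
      hH.continuousOn_kernel hu
    have hcc : Continuous fun p : ℝ × ℝ => K' (p.1 - p.2) i j * u' p.2 j :=
      (((continuous_apply j).comp ((continuous_apply i).comp hK')).comp
        (continuous_fst.sub continuous_snd)).mul (((continuous_apply j).comp hu').comp
          continuous_snd)
    have hval : ∀ t ∈ Icc 0 T, ∀ τ ∈ Icc 0 t,
        invLaplace (H i j) (t - τ) * u τ j = K' (t - τ) i j * u' τ j := fun t ht τ hτ => by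
      rw [← huu' ⟨hτ.1, hτ.2.trans ht.2⟩, ← hKK' (show (0 : ℝ) ≤ t - τ from sub_nonneg.2 hτ.2)]
      rfl
    constructor
    · have hcont : Continuous fun t => ∫ τ in (0 : ℝ)..t, K' (t - τ) i j * u' τ j :=
        intervalIntegral.continuous_parametric_intervalIntegral_of_continuous
          (f := fun t τ => K' (t - τ) i j * u' τ j) hcc continuous_id
      refine hcont.continuousOn.congr fun t ht => ?_
      exact intervalIntegral.integral_congr fun τ hτ => hval t ht τ (by rwa [uIcc_of_le ht.1] at hτ)
    · intro t ht
      refine intervalIntegrable_of_continuousOn_Icc ht.1 (ContinuousOn.congr (f := fun τ =>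
        K' (t - τ) i j * u' τ j) ?_ fun τ hτ => hval t ht τ hτ)
      exact (hcc.comp (continuous_const.prodMk continuous_id)).continuousOn
  refine (Negligible.sum Finset.univ fun j _ =>
    (hH.isInvLaplace i j).negligible_convolution hT (hui j)).congr'
    (Eventually.of_forall fun s => ?_)
  have hEq : EqOn (fun t => conv (kernel H) u t i)
      (fun t => ∑ j, ∫ τ in (0 : ℝ)..t, invLaplace (H i j) (t - τ) * u τ j) (Icc 0 T) := by
    intro t ht
    simp only [conv]
    rw [integral_apply_of_intervalIntegrable
      (intervalIntegrable_conv hT hH.continuousOn_kernel hu ht),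
      ← intervalIntegral.integral_finsetSum fun j _ => (hs j).2 t ht]
    rfl
  beta_reduce
  rw [laplace_apply hT hc, lap_congr hT hEq,
    lap_sum _ fun j _ => intervalIntegrable_of_continuousOn_Icc hT (hs j).1]
  simp only [Matrix.mulVec, dotProduct, laplace_apply hT hu, evM, Matrix.of_apply,
    Finset.sum_sub_distrib]

theorem HasLimit.strictlyProper_sub {H : RatMat a b} {L : Matrix (Fin a) (Fin b) ℝ}
    (hH : HasLimit H L) : StrictlyProper (H - constM L) := by
  have := hH.sub (hasLimit_constM L)
  rwa [sub_self] at this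

/-- A proper rational matrix with limit `L` acts on signals as `L` plus a convolution. -/
theorem HasLimit.represents {H : RatMat a b} {L : Matrix (Fin a) (Fin b) ℝ}
    (hH : HasLimit H L) (hT : 0 ≤ T) {F : ℝ → Fin b → ℝ} {u : ℝ → Fin b → ℝ}
    (hu : Represents T F u) :
    Represents T (fun s => evM H s *ᵥ F s)
      fun t => L *ᵥ u t + conv (kernel (H - constM L)) u t := by
  have h1 : Represents T (fun s => L *ᵥ laplace T u s) fun t => L *ᵥ u t :=
    ⟨continuousOn_mulVec L hu.1, EqUpTo.of_eventuallyEq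
      (Eventually.of_forall fun s => (laplace_mulVec hT L hu.1 s).symm)⟩
  refine (h1.add hT (hH.strictlyProper_sub.represents_conv hT hu.1)).of_eqUpTo
    ((hu.2.mulVec H).trans (EqUpTo.of_eventuallyEq ?_))
  filter_upwards [evM_sub_eventually H (constM L)] with s hs
  rw [hs, evM_constM, ← Matrix.add_mulVec, add_sub_cancel]

theorem Proper.exists_represents {H : RatMat a b} (hH : Proper H) (hT : 0 ≤ T)
    {F : ℝ → Fin b → ℝ} (hu : ∃ u, Represents T F u) :
    ∃ w, Represents T (fun s => evM H s *ᵥ F s) w :=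
  let ⟨_, hL⟩ := hH
  let ⟨_, hu⟩ := hu
  ⟨_, hL.represents hT hu⟩

/-- A strictly proper rational matrix applied to a constant vector is the transform of its kernel
applied to that vector. -/
theorem StrictlyProper.represents_kernel_mulVec {H : RatMat a b} (hH : StrictlyProper H)
    (hT : 0 ≤ T) (d : Fin b → ℝ) :
    Represents T (fun s => evM H s *ᵥ d) fun t => kernel H t *ᵥ d := by
  have hK : ∀ i j, ContinuousOn (invLaplace (H i j)) (Icc 0 T) := fun i j =>
    (hH.isInvLaplace i j).1.mono Icc_subset_Ici_self
  have hc : ContinuousOn (fun t => kernel H t *ᵥ d) (Icc 0 T) :=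
    (continuous_id.matrix_mulVec continuous_const :
      Continuous fun M : Matrix (Fin a) (Fin b) ℝ => M *ᵥ d).comp_continuousOn
        (hH.continuousOn_kernel.mono Icc_subset_Ici_self)
  refine ⟨hc, eqUpTo_iff.2 fun i => ?_⟩
  refine (Negligible.sum Finset.univ fun j _ =>
    (((hH.isInvLaplace i j).negligible hT).pow_mul (g := fun _ => d j) (n := 0)
      (by simpa using isBigO_const_const (d j) (one_ne_zero (α := ℝ)) atTop))).congr'
    (Eventually.of_forall fun s => ?_)
  beta_reduce
  rw [laplace_apply hT hc]
  simp only [Matrix.mulVec, dotProduct, kernel, evM, Matrix.of_apply]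
  have e : (fun t => ∑ j, invLaplace (H i j) t * d j) =
      fun t => ∑ j, d j * invLaplace (H i j) t := by
    ext t; exact Finset.sum_congr rfl fun j _ => mul_comm _ _
  rw [e, lap_sum _ fun j _ =>
    (intervalIntegrable_of_continuousOn_Icc hT (hK i j)).const_mul (d j)]
  simp only [lap_const_mul, mul_sub, Finset.sum_sub_distrib]
  congr 1
  exact Finset.sum_congr rfl fun j _ => mul_comm _ _

/-- If `H` is strictly proper then `s H(s)` is proper. -/
theorem StrictlyProper.proper_X_smul {H : RatMat a b} (hH : StrictlyProper H) :
    Proper ((RatFunc.X : RatFunc ℝ) • H) := by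
  refine proper_of_isBigO fun i j => ?_
  have h1 := (hH.represents_kernel_mulVec zero_le_one (Pi.single j 1)).isBigO_inv one_pos i
  simp only [Matrix.mulVec_single_one] at h1
  refine ((isBigO_refl (fun s : ℝ => s) atTop).mul h1).congr' ?_ ?_
  · filter_upwards [ev_mul_eventually RatFunc.X (H i j)] with s hs
    simp [hs, evM]
  · filter_upwards [eventually_ne_atTop 0] with s hs
    exact mul_inv_cancel₀ hs

theorem evM_mul_mulVec (A : RatMat a b) (B : RatMat b c) (F : ℝ → Fin c → ℝ) :
    EqUpTo T (fun s => evM (A * B) s *ᵥ F s) fun s => evM A s *ᵥ evM B s *ᵥ F s := by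
  refine EqUpTo.of_eventuallyEq ?_
  filter_upwards [evM_mul_eventually A B] with s hs
  rw [hs, Matrix.mulVec_mulVec]

theorem evM_inv_mulVec {A : RatMat n n} (hA : A.det ≠ 0) (F : ℝ → Fin n → ℝ) :
    EqUpTo T (fun s => evM A⁻¹ s *ᵥ evM A s *ᵥ F s) F := by
  refine EqUpTo.of_eventuallyEq ?_
  filter_upwards [evM_inv_mul_eventually hA] with s hs
  rw [Matrix.mulVec_mulVec, hs, Matrix.one_mulVec]

/-! ### Spectral radius and powers of a matrix -/

section Norm

attribute [local instance] Matrix.linftyOpNormedRing Matrix.linftyOpNormedAlgebra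

theorem nnnorm_map_algebraMap (M : Matrix (Fin p) (Fin p) ℝ) :
    ‖M.map (algebraMap ℝ ℂ)‖₊ = ‖M‖₊ := by
  rw [Matrix.linfty_opNNNorm_def, Matrix.linfty_opNNNorm_def]
  simp

theorem map_algebraMap_pow (M : Matrix (Fin p) (Fin p) ℝ) (n : ℕ) :
    M.map (algebraMap ℝ ℂ) ^ n = (M ^ n).map (algebraMap ℝ ℂ) :=
  (map_pow (algebraMap ℝ ℂ).mapMatrix M n).symm

/-- Gelfand's formula: a matrix of spectral radius less than one has a power of small norm. -/
theorem exists_norm_pow_mulVec_le {M : Matrix (Fin p) (Fin p) ℝ} (hM : rho M < 1) :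
    ∃ b : ℝ, 0 < b ∧ b < 1 ∧ ∃ n, ∀ x, ‖M ^ (n + 1) *ᵥ x‖ ≤ b ^ (n + 1) * ‖x‖ := by
  have : CompleteSpace (Matrix (Fin p) (Fin p) ℂ) := FiniteDimensional.complete ℂ _
  obtain ⟨b, hb, hb1⟩ := ENNReal.lt_iff_exists_nnreal_btwn.1 hM
  have h1 := spectrum.pow_nnnorm_pow_one_div_tendsto_nhds_spectralRadius
    (M.map (algebraMap ℝ ℂ))
  obtain ⟨n, hn, hn0⟩ := ((h1.eventually_lt_const hb).and (eventually_ge_atTop 1)).exists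
  obtain ⟨n, rfl⟩ := Nat.exists_eq_add_of_le' hn0
  have h2 : ‖M ^ (n + 1)‖₊ ≤ b ^ (n + 1) := by
    rw [map_algebraMap_pow, nnnorm_map_algebraMap, one_div,
      ENNReal.rpow_inv_lt_iff (by positivity)] at hn
    rw [ENNReal.rpow_natCast] at hn
    exact_mod_cast hn.le
  have hb0 : 0 < b := by
    by_contra h0
    simp only [not_lt, nonpos_iff_eq_zero] at h0
    simp [h0] at hb
  refine ⟨b, hb0, by exact_mod_cast hb1, n, fun x => ?_⟩
  refine (Matrix.linfty_opNorm_mulVec _ _).trans ?_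
  gcongr
  exact_mod_cast h2

theorem rho_lt_one_of_tendsto_pow {M : Matrix (Fin p) (Fin p) ℝ}
    (h : ∀ v, Tendsto (fun k : ℕ => M ^ k *ᵥ v) atTop (𝓝 0)) : rho M < 1 := by
  have hentry : ∀ i j, Tendsto (fun k : ℕ => ‖(M ^ k) i j‖₊) atTop (𝓝 0) := fun i j => by
    have := (tendsto_pi_nhds.1 (h (Pi.single j 1)) i).nnnorm
    simpa using this
  have hnorm : Tendsto (fun k : ℕ => ‖M ^ k‖₊ * ‖(1 : Matrix (Fin p) (Fin p) ℂ)‖₊) atTop (𝓝 0) := by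
    have h1 : Tendsto (fun k : ℕ => ∑ i, ∑ j, ‖(M ^ k) i j‖₊) atTop (𝓝 0) := by
      simpa using tendsto_finsetSum Finset.univ fun i _ =>
        tendsto_finsetSum Finset.univ fun j _ => hentry i j
    have h2 := h1.mul_const ‖(1 : Matrix (Fin p) (Fin p) ℂ)‖₊
    rw [zero_mul] at h2
    refine tendsto_of_tendsto_of_tendsto_of_le_of_le tendsto_const_nhds h2
      (fun k => zero_le) fun k => ?_
    dsimp only
    gcongr
    rw [Matrix.linfty_opNNNorm_def]
    exact Finset.sup_le fun i _ =>
      Finset.single_le_sum (f := fun i => ∑ j, ‖(M ^ k) i j‖₊) (fun _ _ => zero_le)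
        (Finset.mem_univ i)
  obtain ⟨k, hk, hk0⟩ := ((hnorm.eventually_lt_const zero_lt_one).and
    (eventually_ge_atTop 1)).exists
  obtain ⟨n, rfl⟩ := Nat.exists_eq_add_of_le' hk0
  refine (spectrum.spectralRadius_le_pow_nnnorm_pow_one_div ℂ
    (M.map (algebraMap ℝ ℂ)) n).trans_lt ?_
  rw [map_algebraMap_pow, nnnorm_map_algebraMap, ← ENNReal.mul_rpow_of_nonneg _ _ (by positivity)]
  exact ENNReal.rpow_lt_one (by exact_mod_cast hk) (by positivity)

end Norm

/-- A kernel vector of `L` would be fixed by all powers of `1 - L`. -/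
theorem det_ne_zero_of_rho_one_sub_lt {L : Matrix (Fin p) (Fin p) ℝ} (hL : rho (1 - L) < 1) :
    L.det ≠ 0 := by
  intro h0
  obtain ⟨v, hv, hLv⟩ := Matrix.exists_mulVec_eq_zero_iff.2 h0
  obtain ⟨b, hb0, hb1, n, hn⟩ := exists_norm_pow_mulVec_le hL
  have h1 : ∀ k : ℕ, (1 - L) ^ k *ᵥ v = v := fun k => by
    induction k with
    | zero => simp
    | succ k ih =>
      rw [pow_succ, ← Matrix.mulVec_mulVec, Matrix.sub_mulVec, hLv, Matrix.one_mulVec, sub_zero, ih]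
  have h2 := hn v
  rw [h1] at h2
  have h3 : 0 < ‖v‖ := norm_pos_iff.2 hv
  have h4 : b ^ (n + 1) < 1 := pow_lt_one₀ hb0.le hb1 n.succ_ne_zero
  nlinarith

/-- A norm equivalent to the given one for which a matrix of spectral radius less than one is a
contraction: `N(x) = ∑_{i ≤ n} b⁻ⁱ ‖Mⁱ x‖`. -/
theorem exists_adapted_norm {M : Matrix (Fin p) (Fin p) ℝ} (hM : rho M < 1) :
    ∃ (N : (Fin p → ℝ) → ℝ) (b C : ℝ), 0 ≤ b ∧ b < 1 ∧ 0 ≤ C ∧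
      (∀ x y, N (x + y) ≤ N x + N y) ∧ (∀ x, ‖x‖ ≤ N x) ∧ (∀ x, N x ≤ C * ‖x‖) ∧
      ∀ x, N (M *ᵥ x) ≤ b * N x := by
  obtain ⟨b, hb0, hb1, n, hn⟩ := exists_norm_pow_mulVec_le hM
  have hκ : ∀ i, ∃ κ, 0 ≤ κ ∧ ∀ x, ‖M ^ i *ᵥ x‖ ≤ κ * ‖x‖ := fun i => by
    refine ⟨p * ∑ k, ∑ l, |(M ^ i) k l|, by positivity,
      norm_mulVec_le (by positivity) fun k l => ?_⟩
    calc _ ≤ ∑ l, |(M ^ i) k l| := Finset.single_le_sum (f := fun l => |(M ^ i) k l|)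
          (fun _ _ => abs_nonneg _) (Finset.mem_univ l)
      _ ≤ _ := Finset.single_le_sum (f := fun k => ∑ l, |(M ^ i) k l|)
          (fun _ _ => Finset.sum_nonneg fun _ _ => abs_nonneg _) (Finset.mem_univ k)
  choose κ hκ0 hκ using hκ
  refine ⟨fun x => ∑ i ∈ Finset.range (n + 1), b⁻¹ ^ i * ‖M ^ i *ᵥ x‖, b,
    ∑ i ∈ Finset.range (n + 1), b⁻¹ ^ i * κ i, hb0.le, hb1,
    Finset.sum_nonneg fun i _ => mul_nonneg (by positivity) (hκ0 i), fun x y => ?_, fun x => ?_,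
    fun x => ?_, fun x => ?_⟩
  · rw [← Finset.sum_add_distrib]
    refine Finset.sum_le_sum fun i _ => ?_
    rw [← mul_add, Matrix.mulVec_add]
    gcongr
    exact norm_add_le _ _
  · have := Finset.single_le_sum (f := fun i => b⁻¹ ^ i * ‖M ^ i *ᵥ x‖)
      (s := Finset.range (n + 1)) (fun i _ => by positivity) (Finset.mem_range.2 n.succ_pos)
    simpa using this
  · rw [Finset.sum_mul]
    refine Finset.sum_le_sum fun i _ => ?_
    rw [mul_assoc]
    gcongr
    exact hκ i x
  · have h1 : ∀ i, b⁻¹ ^ i * ‖M ^ i *ᵥ M *ᵥ x‖ = b * (b⁻¹ ^ (i + 1) * ‖M ^ (i + 1) *ᵥ x‖) :=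
      fun i => by
        rw [Matrix.mulVec_mulVec, ← pow_succ, pow_succ b⁻¹]
        field_simp
    simp only [h1, ← Finset.mul_sum]
    refine mul_le_mul_of_nonneg_left ?_ hb0.le
    rw [Finset.sum_range_succ, Finset.sum_range_succ' (fun i => b⁻¹ ^ i * ‖M ^ i *ᵥ x‖)]
    refine add_le_add le_rfl ?_
    rw [pow_zero, pow_zero, Matrix.one_mulVec, one_mul, inv_pow, inv_mul_le_iff₀ (by positivity)]
    exact hn x

/-! ### Decay of the homogeneous iteration -/

/-- The iterates of `v ↦ M v + K * v` tend to `0` uniformly on `[0, T]` if `ρ(M) < 1`: in the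
adapted norm and with a weight `exp (λ t)` for large `λ` the Volterra part is a small
perturbation of the contraction `M`. -/
theorem tendstoUniformlyOn_zero_of_recursion {M : Matrix (Fin p) (Fin p) ℝ} (hM : rho M < 1)
    {K : ℝ → Matrix (Fin p) (Fin p) ℝ} (hK : ContinuousOn K (Ici 0)) {v : ℕ → ℝ → Fin p → ℝ}
    (hv : ∀ k, ContinuousOn (v k) (Icc 0 T))
    (hrec : ∀ k, ∀ t ∈ Icc 0 T, v (k + 1) t = M *ᵥ v k t + conv K (v k) t) :
    TendstoUniformlyOn v 0 atTop (Icc 0 T) := by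
  obtain ⟨N, b, C, hb0, hb1, hC, hadd, hle, hge, hcontr⟩ := exists_adapted_norm hM
  obtain ⟨κ, hκ0, hκ⟩ := exists_norm_conv_le T hK
  obtain ⟨B, hB⟩ := isCompact_Icc.exists_bound_of_continuousOn (hv 0)
  -- In the weighted norm the Volterra part is bounded by `C κ / l`, because
  -- `∫₀ᵗ exp (l τ) dτ ≤ exp (l t) / l`; the rate `c = b + C κ / l` is less than `1` for large `l`.
  set l : ℝ := 2 * (C * κ) / (1 - b) + 1 with hl
  have h1b : 0 < 1 - b := sub_pos.2 hb1
  have hl0 : 0 < l := by positivity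
  set c : ℝ := b + C * κ / l with hc
  have hc0 : 0 ≤ c := by positivity
  have hc1 : c < 1 := by
    have h2 : C * κ / l < 1 - b := by
      rw [div_lt_iff₀ hl0, hl, mul_add, mul_div_cancel₀ _ h1b.ne']
      have : 0 ≤ C * κ := by positivity
      linarith
    linarith
  set D : ℝ := C * |B| with hD
  have hD0 : 0 ≤ D := by positivity
  have key : ∀ k, ∀ t ∈ Icc 0 T, N (v k t) ≤ D * Real.exp (l * t) * c ^ k := by
    intro k
    induction k with
    | zero =>
      intro t ht
      have h1 : 1 ≤ Real.exp (l * t) := Real.one_le_exp (mul_nonneg hl0.le ht.1)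
      calc N (v 0 t) ≤ C * ‖v 0 t‖ := hge _
        _ ≤ D := mul_le_mul_of_nonneg_left ((hB t ht).trans (le_abs_self _)) hC
        _ ≤ D * Real.exp (l * t) * c ^ 0 := by
          rw [pow_zero, mul_one]; exact le_mul_of_one_le_right hD0 h1
    | succ k ih =>
      intro t ht
      have hd : ∀ τ, HasDerivAt (fun τ => D * c ^ k / l * Real.exp (l * τ))
          (D * Real.exp (l * τ) * c ^ k) τ := fun τ => by
        have h := (((hasDerivAt_id τ).const_mul l).exp).const_mul (D * c ^ k / l)
        refine h.congr_deriv ?_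
        simp only [id]
        field_simp
      have hint : IntervalIntegrable (fun τ => D * Real.exp (l * τ) * c ^ k) volume 0 t :=
        (by fun_prop : Continuous fun τ => D * Real.exp (l * τ) * c ^ k).intervalIntegrable _ _
      have hI : ∫ τ in (0 : ℝ)..t, ‖v k τ‖ ≤ D * c ^ k / l * Real.exp (l * t) := by
        calc _ ≤ ∫ τ in (0 : ℝ)..t, D * Real.exp (l * τ) * c ^ k :=
              intervalIntegral.integral_mono_on ht.1
                (intervalIntegrable_of_continuousOn_Icc ht.1
                  ((hv k).mono (Icc_subset_Icc_right ht.2)).norm) hint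
                fun τ hτ => (hle _).trans (ih τ ⟨hτ.1, hτ.2.trans ht.2⟩)
          _ = D * c ^ k / l * Real.exp (l * t) - D * c ^ k / l * Real.exp (l * 0) :=
              intervalIntegral.integral_eq_sub_of_hasDerivAt (fun τ _ => hd τ) hint
          _ ≤ _ := sub_le_self _ (by positivity)
      rw [hrec k t ht]
      calc N (M *ᵥ v k t + conv K (v k) t) ≤ N (M *ᵥ v k t) + N (conv K (v k) t) := hadd _ _
        _ ≤ b * N (v k t) + C * ‖conv K (v k) t‖ := add_le_add (hcontr _) (hge _)
        _ ≤ b * (D * Real.exp (l * t) * c ^ k) +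
            C * (κ * (D * c ^ k / l * Real.exp (l * t))) := by
          gcongr
          · exact ih t ht
          · exact (hκ _ (hv k) t ht).trans (by gcongr)
        _ = D * Real.exp (l * t) * c ^ (k + 1) := by
          rw [pow_succ, hc]; ring
  have hlim : Tendsto (fun k : ℕ => D * Real.exp (l * T) * c ^ k) atTop (𝓝 0) := by
    simpa using (tendsto_pow_atTop_nhds_zero_of_lt_one hc0 hc1).const_mul (D * Real.exp (l * T))
  rw [Metric.tendstoUniformlyOn_iff]
  intro ε hε
  filter_upwards [hlim.eventually_lt_const hε] with k hk t ht
  rw [Pi.zero_apply, dist_zero_left]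
  refine lt_of_le_of_lt ((hle _).trans ((key k t ht).trans ?_)) hk
  have := mul_le_mul_of_nonneg_left ht.2 hl0.le
  gcongr

/-- Convolution with a fixed kernel preserves uniform convergence on `[0, T]`. -/
theorem tendstoUniformlyOn_conv {a b : ℕ} (hT : 0 ≤ T) {K : ℝ → Matrix (Fin a) (Fin b) ℝ}
    (hK : ContinuousOn K (Ici 0)) {u : ℕ → ℝ → Fin b → ℝ} {w : ℝ → Fin b → ℝ}
    (hu : ∀ k, ContinuousOn (u k) (Icc 0 T)) (hw : ContinuousOn w (Icc 0 T))
    (h : TendstoUniformlyOn u w atTop (Icc 0 T)) :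
    TendstoUniformlyOn (fun k => conv K (u k)) (conv K w) atTop (Icc 0 T) := by
  obtain ⟨κ, hκ0, hκ⟩ := exists_norm_conv_le T hK
  rw [Metric.tendstoUniformlyOn_iff] at h ⊢
  intro ε hε
  have hδ : 0 < ε / (κ * T + 1) := by positivity
  filter_upwards [h _ hδ] with k hk t ht
  rw [dist_eq_norm, ← conv_sub hT hK hw (hu k) ht]
  have hI : ∫ τ in (0 : ℝ)..t, ‖w τ - u k τ‖ ≤ T * (ε / (κ * T + 1)) := by
    have h1 : ContinuousOn (fun τ => ‖w τ - u k τ‖) (Icc 0 t) :=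
      ((hw.sub (hu k)).mono (Icc_subset_Icc_right ht.2)).norm
    calc _ ≤ ∫ τ in (0 : ℝ)..t, ε / (κ * T + 1) :=
          intervalIntegral.integral_mono_on ht.1 (intervalIntegrable_of_continuousOn_Icc ht.1 h1)
            intervalIntegrable_const fun τ hτ => by
              have := hk τ ⟨hτ.1, hτ.2.trans ht.2⟩
              rw [dist_eq_norm] at this
              exact this.le
      _ = t * (ε / (κ * T + 1)) := by simp [mul_div_assoc]
      _ ≤ _ := by gcongr; exact ht.2
  calc ‖conv K (fun τ => w τ - u k τ) t‖ ≤ κ * ∫ τ in (0 : ℝ)..t, ‖w τ - u k τ‖ :=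
        hκ _ (hw.sub (hu k)) t ht
    _ ≤ κ * (T * (ε / (κ * T + 1))) := by gcongr
    _ = (κ * T) / (κ * T + 1) * ε := by ring
    _ < 1 * ε := by
        gcongr
        rw [div_lt_one (by positivity)]
        linarith
    _ = ε := one_mul ε

/-! ### Left inverses of a plant of relative degree one -/

theorem RelativeDegreeOne.exists_hasLimit {G : RatMat q p} (hpq : p ≤ q)
    (h : RelativeDegreeOne G) : ∃ N : Matrix (Fin q) (Fin p) ℝ,
      HasLimit ((RatFunc.X : RatFunc ℝ) • G) N ∧ (Nᵀ * N).det ≠ 0 := by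
  obtain ⟨N, hN, hr⟩ := h
  refine ⟨N, hN.congr' ?_, ?_⟩
  · filter_upwards [evM_smul_eventually RatFunc.X G] with s hs
    rw [hs, ev_X]
  · intro h0
    obtain ⟨v, hv, hNv⟩ := Matrix.exists_mulVec_eq_zero_iff.2 h0
    have hrank : (Nᵀ * N).rank = p := by
      rw [Matrix.rank_transpose_mul_self, hr, min_eq_right hpq]
    have hsurj : Function.Surjective (Nᵀ * N).mulVecLin := by
      rw [← LinearMap.range_eq_top]
      exact Submodule.eq_top_of_finrank_eq (by rw [Module.finrank_fin_fun]; exact hrank)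
    exact hv (LinearMap.injective_iff_surjective.2 hsurj (by
      rw [Matrix.mulVecLin_apply, hNv, map_zero]))

/-- With `N = lim s G₁(s)` of full column rank, the Gram matrix of `s G₁(s)` has the invertible
limit `Nᵀ N`, so the usual left inverse of `s G₁(s)` exists and is proper. -/
theorem RelativeDegreeOne.exists_left_inverse {G : RatMat q p} (hpq : p ≤ q)
    (h : RelativeDegreeOne G) :
    ∃ P : RatMat p q, Proper P ∧ P * ((RatFunc.X : RatFunc ℝ) • G) = 1 := by
  obtain ⟨N, hN, hdet⟩ := h.exists_hasLimit hpq
  have hA := hN.transpose.mul hN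
  refine ⟨_, ⟨_, (hA.inv hdet).mul hN.transpose⟩, ?_⟩
  rw [Matrix.mul_assoc, Matrix.nonsing_inv_mul _ (isUnit_iff_ne_zero.2 (hA.det_ne_zero hdet))]

theorem RelativeDegreeOne.det_transpose_mul_self_ne_zero {G : RatMat q p} (hpq : p ≤ q)
    (h : RelativeDegreeOne G) : (Gᵀ * G).det ≠ 0 := by
  obtain ⟨N, hN, hdet⟩ := h.exists_hasLimit hpq
  have h1 := (hN.transpose.mul hN).det_ne_zero hdet
  rw [Matrix.transpose_smul, Matrix.smul_mul, Matrix.mul_smul, Matrix.det_smul,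
    Matrix.det_smul] at h1
  exact right_ne_zero_of_mul (right_ne_zero_of_mul h1)

/-! ### Tests for properness -/

theorem smul_laplace_primitive {v : ℝ → Fin p → ℝ} (hT : 0 < T) (c : Fin p → ℝ)
    (hv : Continuous v) {f : ℝ → Fin p → ℝ} (hf : ContinuousOn f (Icc 0 T))
    (hfv : ∀ t ∈ Icc 0 T, f t = c + ∫ τ in (0 : ℝ)..t, v τ) :
    EqUpTo T (fun s => s • laplace T f s) fun s => c + laplace T v s := by
  refine eqUpTo_iff.2 fun i => ?_
  refine (lap_primitive ((continuous_apply i).comp hv) (c i)).congr'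
    (Eventually.of_forall fun s => ?_)
  beta_reduce
  rw [Pi.add_apply, Pi.smul_apply, laplace_apply hT.le hf, laplace_apply hT.le hv.continuousOn]
  have : EqOn (fun t => c i + ∫ τ in (0 : ℝ)..t, v τ i) (fun t => f t i) (Icc 0 T) :=
    fun t ht => by
      simp only [hfv t ht, Pi.add_apply,
        integral_apply_of_intervalIntegrable (hv.intervalIntegrable _ _)]
  rw [← lap_congr hT.le this]
  rfl

theorem smul_laplace_const (hT : 0 < T) (d : Fin p → ℝ) :
    EqUpTo T (fun s => s • laplace T (fun _ => d) s) fun _ => d := by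
  have := smul_laplace_primitive (v := fun _ => 0) hT d continuous_const
    (f := fun _ => d) continuousOn_const (fun t _ => by simp)
  simpa only [laplace_zero, add_zero] using this

/-- If a rational matrix maps step inputs to continuous signals, then it is proper. -/
theorem proper_of_represents_step (hT : 0 < T) {A : RatMat q p}
    (h : ∀ j, ∃ w, Represents T (fun s => evM A s *ᵥ laplace T (fun _ => Pi.single j 1) s) w) :
    Proper A := by
  refine proper_of_isBigO fun i j => ?_
  obtain ⟨w, hw⟩ := h j
  have h1 := (isBigO_refl (fun s : ℝ => s) atTop).mul (hw.isBigO_inv hT i)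
  have h2 := eqUpTo_iff.1 ((smul_laplace_const hT (Pi.single j 1)).mulVec A) i 0 hT
  have h3 : (fun s => s * (evM A s *ᵥ laplace T (fun _ => Pi.single j 1) s) i) =O[atTop]
      fun _ : ℝ => (1 : ℝ) := by
    refine h1.congr' EventuallyEq.rfl ?_
    filter_upwards [eventually_ne_atTop 0] with s hs
    exact mul_inv_cancel₀ hs
  simp only [zero_mul, neg_zero, Real.exp_zero] at h2
  refine (h3.sub h2).congr_left fun s => ?_
  rw [Matrix.mulVec_smul, Matrix.mulVec_single_one, Pi.smul_apply, smul_eq_mul, sub_sub_cancel]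
  rfl

namespace Plant

variable {S : Plant q p m} {Γ : RatMat p q} {yd : ℝ → Fin q → ℝ}

/-! ### The response of the plant -/

theorem represents_dh (hD : StrictlyProper (Matrix.of fun i (_ : Fin 1) => S.Dh i))
    (hT : 0 ≤ T) : Represents T (fun s i => ev (S.Dh i) s) S.dh := by
  have hi : ∀ i, IsInvLaplace (invLaplace (S.Dh i)) (S.Dh i) := fun i => hD.isInvLaplace i 0
  have hc : ContinuousOn S.dh (Icc 0 T) :=
    continuousOn_pi.2 fun i => (hi i).1.mono Icc_subset_Ici_self
  refine ⟨hc, eqUpTo_iff.2 fun i => ((hi i).negligible hT).congr'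
    (Eventually.of_forall fun s => ?_)⟩
  beta_reduce
  rw [laplace_apply hT hc]
  rfl

theorem represents_response (hT : 0 ≤ T) (hG₁ : StrictlyProper S.G₁) (hG₂ : StrictlyProper S.G₂)
    (hD : StrictlyProper (Matrix.of fun i (_ : Fin 1) => S.Dh i)) {u : ℝ → Fin p → ℝ}
    (hu : ContinuousOn u (Icc 0 T)) :
    Represents T (S.output (laplace T u)) (S.response u) := by
  have hd := represents_dh hD hT
  have h1 := hG₁.represents_conv hT hu
  have h2 := (hG₂.represents_conv hT hd.1).of_eqUpTo (hd.2.mulVec S.G₂)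
  have h3 := hG₂.represents_kernel_mulVec hT S.d₀
  refine ((h1.add hT h2).add hT h3).of_eqUpTo (EqUpTo.of_eventuallyEq
    (Eventually.of_forall fun s => ?_))
  simp only [output, disturbance, Matrix.mulVec_add]
  abel

theorem response_zero (u : ℝ → Fin p → ℝ) : S.response u 0 = S.Φ₂ 0 *ᵥ S.d₀ := by
  simp [response]

theorem output_eqUpTo {U U' : ℝ → Fin p → ℝ} (h : EqUpTo T U U') :
    EqUpTo T (S.output U) (S.output U') :=
  (h.mulVec S.G₁).add (EqUpTo.refl _)

/-- Since `s G₁(s)` and `s G₂(s)` are proper, every response to a continuous input is `C¹`. -/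
theorem contDiffOn_response (hT : 0 < T) (hG₁ : StrictlyProper S.G₁)
    (hG₂ : StrictlyProper S.G₂)
    (hD : StrictlyProper (Matrix.of fun i (_ : Fin 1) => S.Dh i)) {u : ℝ → Fin p → ℝ}
    (hu : ContinuousOn u (Icc 0 T)) : ContDiffOn ℝ 1 (S.response u) (Icc 0 T) := by
  obtain ⟨N₁, hN₁⟩ := hG₁.proper_X_smul
  obtain ⟨N₂, hN₂⟩ := hG₂.proper_X_smul
  have h1 := hN₁.represents hT.le (represents_laplace hu)
  have h2 := hN₂.represents hT.le (represents_dh hD hT.le)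
  have h3 := hN₂.strictlyProper_sub.represents_kernel_mulVec hT.le S.d₀
  have h4 := (h1.add hT.le h2).add hT.le h3
  obtain ⟨w, hw, -, hwr⟩ := exists_contDiff_of_smul_eqUpTo (F := S.output (laplace T u))
    (c := N₂ *ᵥ S.d₀) hT.le h4.1 (by
      refine EqUpTo.trans (EqUpTo.of_eventuallyEq ?_) ((EqUpTo.refl fun _ => N₂ *ᵥ S.d₀).add h4.2)
      filter_upwards [evM_smul_eventually RatFunc.X S.G₁, evM_smul_eventually RatFunc.X S.G₂,
        evM_sub_eventually ((RatFunc.X : RatFunc ℝ) • S.G₂) (constM N₂)] with s e1 e2 e3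
      rw [e3, evM_constM, e1, e2, ev_X]
      simp only [output, disturbance, Matrix.mulVec_add, Matrix.sub_mulVec, Matrix.smul_mulVec,
        smul_add]
      abel)
  exact hw.contDiffOn.congr
    ((represents_response hT.le hG₁ hG₂ hD hu).eqOn hT hwr)

theorem represents_disturbance (hT : 0 ≤ T) (hG₁ : StrictlyProper S.G₁)
    (hG₂ : StrictlyProper S.G₂)
    (hD : StrictlyProper (Matrix.of fun i (_ : Fin 1) => S.Dh i)) :
    Represents T S.disturbance (S.response fun _ => 0) := by
  have := represents_response hT hG₁ hG₂ hD (u := fun _ => 0) continuousOn_const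
  refine this.of_eqUpTo (EqUpTo.of_eventuallyEq (Eventually.of_forall fun s => ?_))
  simp [output, laplace_zero]

/-- The residual `Y_d - G₂ D` starts at zero, so `s (Y_d - G₂ D)` is again a continuous signal. -/
theorem Admissible.represents_smul_residual (hT : 0 < T) (hG₁ : StrictlyProper S.G₁)
    (hG₂ : StrictlyProper S.G₂)
    (hD : StrictlyProper (Matrix.of fun i (_ : Fin 1) => S.Dh i)) (hyd : S.Admissible T yd) :
    ∃ v, Represents T (fun s => s • S.residual T yd s) v := by
  have hr := (represents_laplace hyd.1.continuousOn).sub hT.le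
    (represents_disturbance hT.le hG₁ hG₂ hD)
  have h0 : yd 0 - S.response (fun _ => 0) 0 = 0 := sub_eq_zero.2
    (hyd.2 _ _ continuousOn_const
      (represents_response hT.le hG₁ hG₂ hD (u := fun _ => 0) continuousOn_const))
  have hc := hyd.1.sub (contDiffOn_response hT hG₁ hG₂ hD (u := fun _ => 0) continuousOn_const)
  obtain ⟨v, hv, hvr⟩ := exists_smul_laplace_eqUpTo hT hc
  refine ⟨v, hv, ((hr.2.smul (g := fun s => s) (k := 1)
    (by simpa using isBigO_refl (fun s : ℝ => s) atTop)).trans hvr).trans ?_⟩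
  refine EqUpTo.of_eventuallyEq (Eventually.of_forall fun s => ?_)
  simp only [h0, zero_add]

theorem represents_residual (hT : 0 < T) (hG₁ : StrictlyProper S.G₁)
    (hG₂ : StrictlyProper S.G₂)
    (hD : StrictlyProper (Matrix.of fun i (_ : Fin 1) => S.Dh i))
    (hyd : ContinuousOn yd (Icc 0 T)) :
    Represents T (S.residual T yd) fun t => yd t - S.response (fun _ => 0) t :=
  (represents_laplace hyd).sub hT.le (represents_disturbance hT.le hG₁ hG₂ hD)

theorem output_sub_disturbance (U : ℝ → Fin p → ℝ) (s : ℝ) :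
    S.output U s - S.disturbance s = evM S.G₁ s *ᵥ U s := by
  simp [output]

/-- A trackable trajectory is tracked by a continuous input, because `s G₁(s)` has a proper
left inverse. -/
theorem Trackable.exists_continuous (hT : 0 < T) (hpq : p ≤ q) (hG₁ : StrictlyProper S.G₁)
    (hG₂ : StrictlyProper S.G₂)
    (hD : StrictlyProper (Matrix.of fun i (_ : Fin 1) => S.Dh i))
    (hdeg : RelativeDegreeOne S.G₁) (hyd : S.Admissible T yd) (htr : S.Trackable T yd) :
    ∃ ud, ContinuousOn ud (Icc 0 T) ∧
      EqUpTo T (fun s => evM S.G₁ s *ᵥ laplace T ud s) (S.residual T yd) := by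
  obtain ⟨ud, -, hud⟩ := htr
  obtain ⟨P, hP, hPG⟩ := hdeg.exists_left_inverse hpq
  obtain ⟨w, hw⟩ := hP.exists_represents hT.le (hyd.represents_smul_residual hT hG₁ hG₂ hD)
  have h1 : EqUpTo T (laplace T ud) fun s => evM P s *ᵥ s • S.residual T yd s := by
    refine EqUpTo.trans ?_ ((hud.smul (g := fun s => s) (k := 1)
      (by simpa using isBigO_refl (fun s : ℝ => s) atTop)).mulVec P)
    refine EqUpTo.of_eventuallyEq ?_
    filter_upwards [evM_mul_eventually P ((RatFunc.X : RatFunc ℝ) • S.G₁),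
      evM_smul_eventually RatFunc.X S.G₁] with s e1 e2
    rw [hPG, evM_one, e2, ev_X] at e1
    rw [← Matrix.smul_mulVec, Matrix.mulVec_mulVec, ← e1, Matrix.one_mulVec]
  exact ⟨w, hw.1, ((h1.trans hw.2).symm.mulVec S.G₁).trans hud⟩

/-! ### The updating law -/

/-- The updating law in the form `U_{k+1} = (I - Γ G₁) U_k + Γ (Y_d - G₂ D)`. Evaluation is
multiplicative only away from poles, hence the equality for large `s` only. -/
theorem ilcInput_succ (S : Plant q p m) (Γ : RatMat p q) (T : ℝ) (yd : ℝ → Fin q → ℝ)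
    (u₀ : ℝ → Fin p → ℝ) (k : ℕ) :
    EqUpTo T (S.ilcInput Γ T yd u₀ (k + 1)) fun s =>
      evM (1 - Γ * S.G₁) s *ᵥ S.ilcInput Γ T yd u₀ k s + evM Γ s *ᵥ S.residual T yd s := by
  refine EqUpTo.of_eventuallyEq ?_
  filter_upwards [evM_sub_eventually 1 (Γ * S.G₁), evM_mul_eventually Γ S.G₁] with s e1 e2
  rw [e1, e2, evM_one]
  simp only [ilcInput, output, residual, Matrix.sub_mulVec, Matrix.mulVec_sub, Matrix.mulVec_add,
    Matrix.one_mulVec, Matrix.mulVec_mulVec]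
  abel

theorem proper_one_sub {A : RatMat p p} (hA : Proper A) : Proper (1 - A) :=
  let ⟨_, hL⟩ := hA
  ⟨_, hasLimit_one.sub hL⟩

/-- Step inputs show that `Γ G₁` has to be proper, and the zero input that `Γ (Y_d - G₂ D)` has to
be a continuous signal. Conversely both are preserved by `U ↦ (I - Γ G₁) U + Γ (Y_d - G₂ D)`. -/
theorem continuousInputs_iff (hT : 0 < T) :
    S.ContinuousInputs Γ T yd ↔
      Proper (Γ * S.G₁) ∧ ∃ w, Represents T (fun s => evM Γ s *ᵥ S.residual T yd s) w := by
  constructor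
  · intro h
    have hw : ∃ w, Represents T (fun s => evM Γ s *ᵥ S.residual T yd s) w := by
      obtain ⟨w, hw⟩ := h (fun _ => 0) continuousOn_const 1
      refine ⟨w, hw.of_eqUpTo (EqUpTo.trans ?_ (ilcInput_succ S Γ T yd _ 0).symm)⟩
      refine EqUpTo.of_eventuallyEq (Eventually.of_forall fun s => ?_)
      simp [ilcInput, laplace_zero]
    refine ⟨proper_of_represents_step hT fun j => ?_, hw⟩
    obtain ⟨w, hw⟩ := hw
    obtain ⟨u₁, hu₁⟩ := h (fun _ => Pi.single j 1) continuousOn_const 1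
    have h1 := ((represents_laplace (T := T) (f := fun _ => Pi.single j 1)
      continuousOn_const).add hT.le hw).sub hT.le
      (hu₁.of_eqUpTo (ilcInput_succ S Γ T yd _ 0).symm)
    refine ⟨_, h1.of_eqUpTo (EqUpTo.of_eventuallyEq ?_)⟩
    filter_upwards [evM_sub_eventually 1 (Γ * S.G₁)] with s e1
    rw [e1, evM_one]
    simp only [ilcInput, Matrix.sub_mulVec, Matrix.one_mulVec]
    abel
  · rintro ⟨hP, w, hw⟩ u₀ hu₀ k
    induction k with
    | zero => exact ⟨u₀, represents_laplace hu₀⟩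
    | succ k ih =>
      obtain ⟨v, hv⟩ := (proper_one_sub hP).exists_represents hT.le ih
      exact ⟨_, (hv.add hT.le hw).of_eqUpTo (ilcInput_succ S Γ T yd u₀ k)⟩

/-- Here `Γ (Y_d - G₂ D) = (Γ / s) · s (Y_d - G₂ D)`. -/
theorem ContinuousInputs.of_properAfterIntegration (hT : 0 < T) (hG₁ : StrictlyProper S.G₁)
    (hG₂ : StrictlyProper S.G₂)
    (hD : StrictlyProper (Matrix.of fun i (_ : Fin 1) => S.Dh i))
    (hyd : S.Admissible T yd) (hΓ : ProperAfterIntegration Γ) : S.ContinuousInputs Γ T yd := by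
  rw [properAfterIntegration_iff] at hΓ
  refine (continuousInputs_iff hT).2 ⟨?_, ?_⟩
  · obtain ⟨L, hL⟩ := hΓ
    obtain ⟨N, hN⟩ := hG₁.proper_X_smul
    have := hL.mul hN
    rw [Matrix.smul_mul, Matrix.mul_smul, inv_smul_smul₀ RatFunc.X_ne_zero] at this
    exact ⟨_, this⟩
  · obtain ⟨w, hw⟩ := hΓ.exists_represents hT.le (hyd.represents_smul_residual hT hG₁ hG₂ hD)
    refine ⟨w, hw.of_eqUpTo (EqUpTo.of_eventuallyEq ?_)⟩
    filter_upwards [evM_smul_eventually (RatFunc.X)⁻¹ Γ, ev_inv_X_eventually,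
      eventually_ne_atTop 0] with s e1 e2 hs
    rw [e1, e2, Matrix.smul_mulVec, Matrix.mulVec_smul, inv_smul_smul₀ hs]

/-- The difference of two solutions of the updating law is a solution of the homogeneous
recursion in the time domain. -/
theorem sub_recursion (hT : 0 < T) {A : RatMat p p} {M : Matrix (Fin p) (Fin p) ℝ}
    (hA : HasLimit A M) {W F F' G G' : ℝ → Fin p → ℝ} {f f' g g' : ℝ → Fin p → ℝ}
    (hF : EqUpTo T F' fun s => evM A s *ᵥ F s + W s)
    (hG : EqUpTo T G' fun s => evM A s *ᵥ G s + W s)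
    (hf : Represents T F f) (hf' : Represents T F' f') (hg : Represents T G g)
    (hg' : Represents T G' g') :
    ∀ t ∈ Icc 0 T, f' t - g' t =
      M *ᵥ (f t - g t) + conv (kernel (A - constM M)) (fun τ => f τ - g τ) t := by
  have h1 := hA.represents hT.le (hf.sub hT.le hg)
  have h2 := hf'.sub hT.le hg'
  refine h2.eqOn hT (h1.of_eqUpTo ((hF.sub hG).trans (EqUpTo.of_eventuallyEq
    (Eventually.of_forall fun s => ?_))))
  simp only [Matrix.mulVec_sub]
  abel

/-- Convolutions vanish at time `0`, so initial values are just multiplied by `M`. -/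
theorem pow_mulVec_of_recursion {M : Matrix (Fin p) (Fin p) ℝ}
    {K : ℝ → Matrix (Fin p) (Fin p) ℝ} (hT : 0 ≤ T) {v : ℕ → ℝ → Fin p → ℝ}
    (hrec : ∀ k, ∀ t ∈ Icc 0 T, v (k + 1) t = M *ᵥ v k t + conv K (v k) t) (k : ℕ) :
    v k 0 = M ^ k *ᵥ v 0 0 := by
  induction k with
  | zero => simp
  | succ k ih =>
    rw [hrec k 0 ⟨le_rfl, hT⟩, ih, Matrix.mulVec_mulVec, ← pow_succ']
    simp [conv]

theorem continuousInputs_of_isRun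
    (h : ∀ u₀, ContinuousOn u₀ (Icc 0 T) → ∃ u y, S.IsRun Γ T yd u₀ u y) :
    S.ContinuousInputs Γ T yd := fun u₀ hu₀ k =>
  let ⟨u, _, hr⟩ := h u₀ hu₀
  ⟨u k, (hr k).1⟩

theorem IsRun.zero_eqOn (hT : 0 < T) {u₀ : ℝ → Fin p → ℝ} {u y}
    (hu₀ : ContinuousOn u₀ (Icc 0 T)) (h : S.IsRun Γ T yd u₀ u y) : EqOn (u 0) u₀ (Icc 0 T) :=
  (h 0).1.eqOn hT (represents_laplace hu₀)

theorem IsRun.sub_recursion (hT : 0 < T) {L : Matrix (Fin p) (Fin p) ℝ}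
    (hL : HasLimit (Γ * S.G₁) L) {u₀ u₀' : ℝ → Fin p → ℝ} {u y u' y'}
    (h : S.IsRun Γ T yd u₀ u y) (h' : S.IsRun Γ T yd u₀' u' y') :
    ∀ k, ∀ t ∈ Icc 0 T, u (k + 1) t - u' (k + 1) t = (1 - L) *ᵥ (u k t - u' k t) +
      conv (kernel (1 - Γ * S.G₁ - constM (1 - L))) (fun τ => u k τ - u' k τ) t := fun k =>
  Plant.sub_recursion hT (hasLimit_one.sub hL) (ilcInput_succ S Γ T yd u₀ k)
    (ilcInput_succ S Γ T yd u₀' k) (h k).1 (h (k + 1)).1 (h' k).1 (h' (k + 1)).1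

/-- Convergence to a limit that does not depend on the initial input forces `ρ(I - L) < 1`:
the difference of two runs at time `0` is multiplied by `I - L` in each step. -/
theorem designCondition_of_convergesPointwise (hT : 0 < T) {uinf : ℝ → Fin p → ℝ}
    (h : ∀ u₀, ContinuousOn u₀ (Icc 0 T) → S.ConvergesPointwise Γ T yd u₀ uinf) :
    S.ContinuousInputs Γ T yd ∧ S.DesignCondition Γ := by
  have hci : S.ContinuousInputs Γ T yd := continuousInputs_of_isRun fun u₀ hu₀ =>
    let ⟨_, _, u, y, hr, _⟩ := h u₀ hu₀
    ⟨u, y, hr⟩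
  obtain ⟨L, hL⟩ := ((continuousInputs_iff hT).1 hci).1
  refine ⟨hci, L, hL, rho_lt_one_of_tendsto_pow fun v => ?_⟩
  have h0 : (0 : ℝ) ∈ Icc 0 T := ⟨le_rfl, hT.le⟩
  obtain ⟨-, -, u, y, hr, hu, -⟩ := h (fun _ => v) continuousOn_const
  obtain ⟨-, -, u', y', hr', hu', -⟩ := h (fun _ => 0) continuousOn_const
  have h1 := pow_mulVec_of_recursion (v := fun k t => u k t - u' k t) hT.le
    (hr.sub_recursion hT hL hr')
  have h2 : u 0 0 - u' 0 0 = v := by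
    rw [hr.zero_eqOn hT continuousOn_const h0, hr'.zero_eqOn hT continuousOn_const h0, sub_zero]
  have h3 := (hu 0 h0).sub (hu' 0 h0)
  rw [sub_self] at h3
  refine h3.congr fun k => ?_
  rw [h1 k, h2]

/-- If `Γ G₁` is nonsingular, then runs which converge do so to the same limit: the difference of
two limits is a fixed point of the homogeneous recursion, hence annihilated by `Γ G₁`. -/
theorem designCondition_of_convergesUniformly (hT : 0 < T) (hdet : (Γ * S.G₁).det ≠ 0)
    (h : ∀ u₀, ContinuousOn u₀ (Icc 0 T) → ∃ uinf, S.ConvergesUniformly Γ T yd u₀ uinf) :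
    S.ContinuousInputs Γ T yd ∧ S.DesignCondition Γ := by
  have hci : S.ContinuousInputs Γ T yd := continuousInputs_of_isRun fun u₀ hu₀ =>
    let ⟨_, _, _, u, y, hr, _⟩ := h u₀ hu₀
    ⟨u, y, hr⟩
  obtain ⟨L, hL⟩ := ((continuousInputs_iff hT).1 hci).1
  refine ⟨hci, L, hL, rho_lt_one_of_tendsto_pow fun v => ?_⟩
  have h0 : (0 : ℝ) ∈ Icc 0 T := ⟨le_rfl, hT.le⟩
  obtain ⟨w, hw, -, u, y, hr, hu, -⟩ := h (fun _ => v) continuousOn_const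
  obtain ⟨w', hw', -, u', y', hr', hu', -⟩ := h (fun _ => 0) continuousOn_const
  have hrec := hr.sub_recursion hT hL hr'
  have hA : HasLimit (1 - Γ * S.G₁) (1 - L) := hasLimit_one.sub hL
  have hK := hA.strictlyProper_sub.continuousOn_kernel
  have hδ : ContinuousOn (fun t => w t - w' t) (Icc 0 T) := hw.sub hw'
  have hlim : TendstoUniformlyOn (fun k t => u k t - u' k t) (fun t => w t - w' t) atTop
      (Icc 0 T) := hu.sub hu'
  have hconv := tendstoUniformlyOn_conv hT.le hK (fun k => (hr k).1.1.sub (hr' k).1.1) hδ hlim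
  have hfix : EqOn (fun t => w t - w' t) (fun t => (1 - L) *ᵥ (w t - w' t) +
      conv (kernel (1 - Γ * S.G₁ - constM (1 - L))) (fun τ => w τ - w' τ) t) (Icc 0 T) := by
    intro t ht
    have h1 := (tendsto_add_atTop_iff_nat 1).2 (hlim.tendsto_at ht)
    have h2 := ((continuous_const.matrix_mulVec continuous_id :
      Continuous fun v => (1 - L) *ᵥ v).tendsto _).comp (hlim.tendsto_at ht)
    have h3 := h2.add (hconv.tendsto_at ht)
    refine tendsto_nhds_unique h1 (h3.congr fun k => ?_)
    exact (hrec k t ht).symm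
  have hrep := hA.represents hT.le (represents_laplace hδ)
  have hker : EqUpTo T (fun s => evM (Γ * S.G₁) s *ᵥ laplace T (fun t => w t - w' t) s)
      fun _ => 0 := by
    have h1 := (EqUpTo.refl (T := T) (laplace T fun t => w t - w' t)).sub hrep.2
    rw [← laplace_congr hT.le hfix] at h1
    simp only [sub_self] at h1
    refine EqUpTo.trans (EqUpTo.of_eventuallyEq ?_) h1
    filter_upwards [evM_sub_eventually 1 (Γ * S.G₁)] with s e1
    rw [e1, evM_one, Matrix.sub_mulVec, Matrix.one_mulVec, sub_sub_cancel]
  have hzero : EqOn (fun t => w t - w' t) (fun _ => 0) (Icc 0 T) := by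
    refine eqOn_of_eqUpTo hT hδ continuousOn_const ?_
    refine (evM_inv_mulVec hdet _).symm.trans ((hker.mulVec (Γ * S.G₁)⁻¹).trans ?_)
    refine EqUpTo.of_eventuallyEq (Eventually.of_forall fun s => ?_)
    simp [laplace_zero]
  have h1 := pow_mulVec_of_recursion (v := fun k t => u k t - u' k t) hT.le hrec
  have h2 : u 0 0 - u' 0 0 = v := by
    rw [hr.zero_eqOn hT continuousOn_const h0, hr'.zero_eqOn hT continuousOn_const h0, sub_zero]
  have h3 := hlim.tendsto_at h0
  rw [show w 0 - w' 0 = 0 from hzero h0] at h3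
  refine h3.congr fun k => ?_
  rw [h1 k, h2]

theorem isRun_response (hT : 0 < T) (hG₁ : StrictlyProper S.G₁) (hG₂ : StrictlyProper S.G₂)
    (hD : StrictlyProper (Matrix.of fun i (_ : Fin 1) => S.Dh i)) {u₀ : ℝ → Fin p → ℝ}
    {u : ℕ → ℝ → Fin p → ℝ} (hu : ∀ k, Represents T (S.ilcInput Γ T yd u₀ k) (u k)) :
    S.IsRun Γ T yd u₀ u fun k => S.response (u k) := fun k =>
  ⟨hu k, (represents_response hT.le hG₁ hG₂ hD (hu k).1).of_eqUpTo (output_eqUpTo (hu k).2)⟩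

theorem DesignCondition.det_ne_zero (h : S.DesignCondition Γ) : (Γ * S.G₁).det ≠ 0 :=
  let ⟨_, hL, hρ⟩ := h
  hL.det_ne_zero (det_ne_zero_of_rho_one_sub_lt hρ)

/-- Under the design condition the limit input is the continuous signal `(Γ G₁)⁻¹ Γ (Y_d - G₂ D)`,
and it attracts all runs uniformly. -/
theorem DesignCondition.exists_limit (hT : 0 < T) (hG₁ : StrictlyProper S.G₁)
    (hG₂ : StrictlyProper S.G₂)
    (hD : StrictlyProper (Matrix.of fun i (_ : Fin 1) => S.Dh i))
    (h : S.DesignCondition Γ) (hci : S.ContinuousInputs Γ T yd) :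
    ∃ uinf, Represents T (fun s => evM ((Γ * S.G₁)⁻¹ * Γ) s *ᵥ S.residual T yd s) uinf ∧
      ∀ u₀ u y, S.IsRun Γ T yd u₀ u y → TendstoUniformlyOn u uinf atTop (Icc 0 T) ∧
        TendstoUniformlyOn y (S.response uinf) atTop (Icc 0 T) := by
  have hdet := h.det_ne_zero
  obtain ⟨L, hL, hρ⟩ := h
  have hA : HasLimit (1 - Γ * S.G₁) (1 - L) := hasLimit_one.sub hL
  have hinv : Proper (Γ * S.G₁)⁻¹ := ⟨_, hL.inv (det_ne_zero_of_rho_one_sub_lt hρ)⟩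
  obtain ⟨uinf, huinf⟩ := hinv.exists_represents hT.le ((continuousInputs_iff hT).1 hci).2
  have huinf' := huinf.of_eqUpTo (evM_mul_mulVec (Γ * S.G₁)⁻¹ Γ (S.residual T yd))
  refine ⟨uinf, huinf', fun u₀ u y hr => ?_⟩
  have hfix : EqUpTo T (laplace T uinf) fun s =>
      evM (1 - Γ * S.G₁) s *ᵥ laplace T uinf s + evM Γ s *ᵥ S.residual T yd s := by
    have h1 : EqUpTo T (fun s => evM (Γ * S.G₁) s *ᵥ laplace T uinf s)
        fun s => evM Γ s *ᵥ S.residual T yd s := by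
      refine (huinf.2.symm.mulVec _).trans (EqUpTo.of_eventuallyEq ?_)
      filter_upwards [evM_mul_eventually (Γ * S.G₁) (Γ * S.G₁)⁻¹] with s e1
      rw [Matrix.mul_nonsing_inv _ (isUnit_iff_ne_zero.2 hdet), evM_one] at e1
      rw [Matrix.mulVec_mulVec, ← e1, Matrix.one_mulVec]
    refine EqUpTo.trans (EqUpTo.of_eventuallyEq ?_) ((EqUpTo.refl fun s =>
      evM (1 - Γ * S.G₁) s *ᵥ laplace T uinf s).add h1)
    filter_upwards [evM_sub_eventually 1 (Γ * S.G₁)] with s e1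
    rw [e1, evM_one, Matrix.sub_mulVec, Matrix.one_mulVec, sub_add_cancel]
  have hrep := represents_laplace huinf.1
  have hv := tendstoUniformlyOn_zero_of_recursion hρ hA.strictlyProper_sub.continuousOn_kernel
    (v := fun k t => u k t - uinf t) (fun k => (hr k).1.1.sub huinf.1) fun k =>
      Plant.sub_recursion hT hA (ilcInput_succ S Γ T yd u₀ k) hfix (hr k).1 (hr (k + 1)).1
        hrep hrep
  have hu : TendstoUniformlyOn u uinf atTop (Icc 0 T) := by
    rw [Metric.tendstoUniformlyOn_iff] at hv ⊢
    intro ε hε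
    filter_upwards [hv ε hε] with k hk t ht
    have := hk t ht
    rwa [Pi.zero_apply, dist_zero_left, ← dist_eq_norm, dist_comm] at this
  refine ⟨hu, ?_⟩
  have hc := tendstoUniformlyOn_conv hT.le hG₁.continuousOn_kernel (fun k => (hr k).1.1)
    huinf.1 hu
  have hy : ∀ k, EqOn (y k) (S.response (u k)) (Icc 0 T) := fun k =>
    (hr k).2.eqOn hT (isRun_response hT hG₁ hG₂ hD (fun k => (hr k).1) k).2
  rw [Metric.tendstoUniformlyOn_iff] at hc ⊢
  intro ε hε
  filter_upwards [hc ε hε] with k hk t ht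
  rw [hy k ht]
  have := hk t ht
  simp only [response]
  rw [dist_add_right, dist_add_right]
  exact this

theorem convergesUniformly_of_forall_isRun (hT : 0 < T) (hG₁ : StrictlyProper S.G₁)
    (hG₂ : StrictlyProper S.G₂)
    (hD : StrictlyProper (Matrix.of fun i (_ : Fin 1) => S.Dh i))
    (hci : S.ContinuousInputs Γ T yd) {uinf : ℝ → Fin p → ℝ} (huinf : ContinuousOn uinf (Icc 0 T))
    (h : ∀ u₀ u y, S.IsRun Γ T yd u₀ u y → TendstoUniformlyOn u uinf atTop (Icc 0 T) ∧
        TendstoUniformlyOn y (S.response uinf) atTop (Icc 0 T)) (u₀ : ℝ → Fin p → ℝ)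
    (hu₀ : ContinuousOn u₀ (Icc 0 T)) : S.ConvergesUniformly Γ T yd u₀ uinf := by
  choose u hu using hci u₀ hu₀
  have hr := isRun_response hT hG₁ hG₂ hD hu
  exact ⟨huinf, contDiffOn_response hT hG₁ hG₂ hD huinf, u, _, hr, h u₀ u _ hr⟩

/-! ### Trackable trajectories, ramps and square plants -/

/-- Adding a ramp to the free response preserves the common initial value of all outputs. -/
theorem admissible_response_add (hT : 0 < T) (hG₁ : StrictlyProper S.G₁)
    (hG₂ : StrictlyProper S.G₂)
    (hD : StrictlyProper (Matrix.of fun i (_ : Fin 1) => S.Dh i)) (d : Fin q → ℝ) :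
    S.Admissible T fun t => S.response (fun _ => 0) t + t • d := by
  refine ⟨(contDiffOn_response hT hG₁ hG₂ hD continuousOn_const).add
    (contDiff_id.smul contDiff_const).contDiffOn, fun u y hu hy => ?_⟩
  beta_reduce
  rw [← (represents_response hT.le hG₁ hG₂ hD hu).eqOn hT hy ⟨le_rfl, hT.le⟩, response_zero,
    response_zero, zero_smul, add_zero]

/-- If the law generates continuous inputs for all trajectories, then it does so for the ramps
`t ↦ t • eⱼ` added to the free response, whose transforms are `eⱼ / s²`; this makes `Γ(s) / s`
proper. -/
theorem properAfterIntegration_of_continuousInputs (hT : 0 < T) (hG₁ : StrictlyProper S.G₁)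
    (hG₂ : StrictlyProper S.G₂)
    (hD : StrictlyProper (Matrix.of fun i (_ : Fin 1) => S.Dh i))
    (h : ∀ yd, S.Admissible T yd → S.ContinuousInputs Γ T yd) : ProperAfterIntegration Γ := by
  refine properAfterIntegration_iff.2 (proper_of_represents_step hT fun j => ?_)
  have hyd := admissible_response_add hT hG₁ hG₂ hD (Pi.single j 1)
  obtain ⟨w, hw⟩ := ((continuousInputs_iff hT).1 (h _ hyd)).2
  have hr := (represents_residual hT hG₁ hG₂ hD hyd.1.continuousOn).2
  simp only [add_sub_cancel_left] at hr
  have hramp := smul_laplace_primitive (v := fun _ => Pi.single j 1) hT 0 continuous_const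
    (f := fun t => t • (Pi.single j 1 : Fin q → ℝ)) (by fun_prop) (fun t _ => by simp)
  simp only [zero_add] at hramp
  refine ⟨w, hw.of_eqUpTo ((hramp.symm.mulVec _).trans
    (EqUpTo.trans (EqUpTo.of_eventuallyEq ?_) (hr.symm.mulVec Γ)))⟩
  filter_upwards [evM_smul_eventually (RatFunc.X)⁻¹ Γ, ev_inv_X_eventually,
    eventually_ne_atTop 0] with s e1 e2 hs
  rw [e1, e2, Matrix.smul_mulVec, Matrix.mulVec_smul, inv_smul_smul₀ hs]

theorem ContinuousInputs.of_proper_of_trackable (hT : 0 < T) (hpq : p ≤ q)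
    (hG₁ : StrictlyProper S.G₁) (hG₂ : StrictlyProper S.G₂)
    (hD : StrictlyProper (Matrix.of fun i (_ : Fin 1) => S.Dh i))
    (hdeg : RelativeDegreeOne S.G₁) (hyd : S.Admissible T yd) (hΓ : Proper (Γ * S.G₁))
    (htr : S.Trackable T yd) : S.ContinuousInputs Γ T yd := by
  obtain ⟨ud, hudc, hud⟩ := htr.exists_continuous hT hpq hG₁ hG₂ hD hdeg hyd
  obtain ⟨w, hw⟩ := hΓ.exists_represents hT.le ⟨ud, represents_laplace hudc⟩
  exact (continuousInputs_iff hT).2 ⟨hΓ, w, hw.of_eqUpTo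
    ((hud.symm.mulVec Γ).trans (evM_mul_mulVec Γ S.G₁ _).symm)⟩

/-- For a square plant `s G₁(s)` has a proper inverse, and `Γ / s = Γ G₁ (s G₁)⁻¹`. -/
theorem properAfterIntegration_of_square {G : RatMat q q} {Γ : RatMat q q}
    (hdeg : RelativeDegreeOne G) (hΓ : Proper (Γ * G)) : ProperAfterIntegration Γ := by
  obtain ⟨P, ⟨R, hR⟩, hPG⟩ := hdeg.exists_left_inverse le_rfl
  obtain ⟨L, hL⟩ := hΓ
  refine properAfterIntegration_iff.2 ⟨L * R, ?_⟩
  have h1 : (RatFunc.X : RatFunc ℝ)⁻¹ • Γ = Γ * G * P := by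
    have h2 := mul_eq_one_comm.1 hPG
    rw [Matrix.smul_mul] at h2
    rw [Matrix.mul_assoc, ← inv_smul_smul₀ (RatFunc.X_ne_zero (K := ℝ)) (G * P), h2,
      Matrix.mul_smul, Matrix.mul_one]
  rw [h1]
  exact hL.mul hR

/-- A trajectory is trackable as soon as it is the response to some continuous input. -/
theorem trackable_of_eqOn_response (hT : 0 < T) (hG₁ : StrictlyProper S.G₁)
    (hG₂ : StrictlyProper S.G₂)
    (hD : StrictlyProper (Matrix.of fun i (_ : Fin 1) => S.Dh i)) {u : ℝ → Fin p → ℝ}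
    (hu : ContinuousOn u (Icc 0 T)) (h : EqOn (S.response u) yd (Icc 0 T)) :
    S.Trackable T yd := by
  refine ⟨u, hu.integrableOn_Icc, ?_⟩
  have h1 := (represents_response hT.le hG₁ hG₂ hD hu).2
  rw [laplace_congr hT.le h] at h1
  have h2 := h1.sub (EqUpTo.refl S.disturbance)
  simp only [output_sub_disturbance] at h2
  exact h2

/-- If `G₁ U_d = Y_d - G₂ D`, then the limit input is `U_d`. -/
theorem limit_eqUpTo_of_trackable (hdet : (Γ * S.G₁).det ≠ 0) {uinf ud : ℝ → Fin p → ℝ}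
    (huinf : EqUpTo T (fun s => evM ((Γ * S.G₁)⁻¹ * Γ) s *ᵥ S.residual T yd s) (laplace T uinf))
    (hud : EqUpTo T (fun s => evM S.G₁ s *ᵥ laplace T ud s) (S.residual T yd)) :
    EqUpTo T (laplace T uinf) (laplace T ud) := by
  refine huinf.symm.trans ((hud.symm.mulVec _).trans ?_)
  refine (evM_mul_mulVec _ S.G₁ _).symm.trans ?_
  rw [Matrix.mul_assoc, Matrix.nonsing_inv_mul _ (isUnit_iff_ne_zero.2 hdet)]
  refine EqUpTo.of_eventuallyEq (Eventually.of_forall fun s => ?_)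
  simp

end Plant

end ILC

end

open ILC ILC.Plant in
theorem theorem3 {q p m : ℕ} (hpq : p ≤ q) (S : ILC.Plant q p m) (Γ : ILC.RatMat p q)
    (T : ℝ) (hT : 0 < T)
    (hG₁ : ILC.StrictlyProper S.G₁) (hG₂ : ILC.StrictlyProper S.G₂)
    (hD : ILC.StrictlyProper (Matrix.of fun i (_ : Fin 1) => S.Dh i))
    (hdeg : ILC.RelativeDegreeOne S.G₁) :
    -- convergence for one trajectory
    (∀ yd, S.Admissible T yd →
      List.TFAE [
        ∃ uinf, ∀ u₀, ContinuousOn u₀ (Set.Icc 0 T) → S.ConvergesPointwise Γ T yd u₀ uinf,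
        ∃ uinf, ∀ u₀, ContinuousOn u₀ (Set.Icc 0 T) → S.ConvergesUniformly Γ T yd u₀ uinf,
        (Γ * S.G₁).det ≠ 0 ∧ ∀ u₀, ContinuousOn u₀ (Set.Icc 0 T) →
          ∃ uinf, S.ConvergesUniformly Γ T yd u₀ uinf,
        S.ContinuousInputs Γ T yd ∧ S.DesignCondition Γ]) ∧
    -- continuity of the inputs
    (∀ yd, S.Admissible T yd →
      (ILC.ProperAfterIntegration Γ ∨
        (ILC.Proper (Γ * S.G₁) ∧ (q = p ∨ S.Trackable T yd))) →
      S.ContinuousInputs Γ T yd) ∧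
    -- convergence for all trajectories
    ((∀ yd, S.Admissible T yd → ∃ uinf, ∀ u₀, ContinuousOn u₀ (Set.Icc 0 T) →
        S.ConvergesUniformly Γ T yd u₀ uinf) ↔
      ILC.ProperAfterIntegration Γ ∧ S.DesignCondition Γ) ∧
    -- the limits
    (S.DesignCondition Γ →
      (Γ * S.G₁).det ≠ 0 ∧ (S.G₁ᵀ * S.G₁).det ≠ 0 ∧
      ∀ yd, S.Admissible T yd → S.ContinuousInputs Γ T yd →
        ∃ uinf, (∀ u₀, ContinuousOn u₀ (Set.Icc 0 T) → S.ConvergesUniformly Γ T yd u₀ uinf) ∧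
          ILC.EqUpTo T (ILC.laplace T uinf)
            (fun s => ILC.evM ((Γ * S.G₁)⁻¹ * Γ) s *ᵥ S.residual T yd s) ∧
          (S.Trackable T yd →
            ILC.EqUpTo T (ILC.laplace T uinf)
              (fun s => ILC.evM ((S.G₁ᵀ * S.G₁)⁻¹ * S.G₁ᵀ) s *ᵥ S.residual T yd s)) ∧
          ∀ u₀, ContinuousOn u₀ (Set.Icc 0 T) → ∀ u y, S.IsRun Γ T yd u₀ u y →
            ((∀ t ∈ Set.Icc 0 T, Filter.Tendsto (fun k => y k t) Filter.atTop (nhds (yd t))) ↔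
              S.Trackable T yd) ∧
            ∃ einf : ℝ → Fin q → ℝ, ContinuousOn einf (Set.Icc 0 T) ∧
              TendstoUniformlyOn (fun k t => yd t - y k t) einf Filter.atTop (Set.Icc 0 T) ∧
              ILC.EqUpTo T (ILC.laplace T einf)
                (fun s => ILC.evM (1 - S.G₁ * (Γ * S.G₁)⁻¹ * Γ) s *ᵥ S.residual T yd s) ∧
              (¬ S.Trackable T yd → ∃ t ∈ Set.Icc 0 T, einf t ≠ 0)) := by
  have hone : ∀ yd, S.Admissible T yd → S.ContinuousInputs Γ T yd → S.DesignCondition Γ →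
      ∃ uinf, ∀ u₀, ContinuousOn u₀ (Set.Icc 0 T) → S.ConvergesUniformly Γ T yd u₀ uinf := by
    intro yd _ hci hdc
    obtain ⟨uinf, hrep, hlim⟩ := hdc.exists_limit hT hG₁ hG₂ hD hci
    exact ⟨uinf, convergesUniformly_of_forall_isRun hT hG₁ hG₂ hD hci hrep.1 hlim⟩
  have hpw : ∀ (yd : ℝ → Fin q → ℝ) (u₀ uinf : ℝ → Fin p → ℝ),
      S.ConvergesUniformly Γ T yd u₀ uinf → S.ConvergesPointwise Γ T yd u₀ uinf := by
    rintro yd u₀ uinf ⟨h1, h2, u, y, hr, hu, hy⟩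
    exact ⟨h1, h2, u, y, hr, fun t ht => hu.tendsto_at ht, fun t ht => hy.tendsto_at ht⟩
  refine ⟨fun yd hyd => ?_, fun yd hyd h => ?_, ⟨fun h => ?_, fun h yd hyd => ?_⟩,
    fun hdc => ⟨hdc.det_ne_zero, hdeg.det_transpose_mul_self_ne_zero hpq, fun yd hyd hci => ?_⟩⟩
  · tfae_have 2 → 1 := fun ⟨uinf, h⟩ => ⟨uinf, fun u₀ hu₀ => hpw yd u₀ uinf (h u₀ hu₀)⟩
    tfae_have 1 → 4 := fun ⟨_, h⟩ => designCondition_of_convergesPointwise hT h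
    tfae_have 4 → 2 := fun h => hone yd hyd h.1 h.2
    tfae_have 4 → 3 := fun h =>
      ⟨h.2.det_ne_zero, fun u₀ hu₀ =>
        let ⟨uinf, hu⟩ := hone yd hyd h.1 h.2
        ⟨uinf, hu u₀ hu₀⟩⟩
    tfae_have 3 → 4 := fun h => designCondition_of_convergesUniformly hT h.1 h.2
    tfae_finish
  · rcases h with h | ⟨h, rfl | htr⟩
    · exact ContinuousInputs.of_properAfterIntegration hT hG₁ hG₂ hD hyd h
    · exact ContinuousInputs.of_properAfterIntegration hT hG₁ hG₂ hD hyd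
        (properAfterIntegration_of_square hdeg h)
    · exact ContinuousInputs.of_proper_of_trackable hT hpq hG₁ hG₂ hD hdeg hyd h htr
  · have h4 : ∀ yd, S.Admissible T yd → S.ContinuousInputs Γ T yd ∧ S.DesignCondition Γ :=
      fun yd hyd =>
        let ⟨_, hu⟩ := h yd hyd
        designCondition_of_convergesPointwise hT fun u₀ hu₀ => hpw yd u₀ _ (hu u₀ hu₀)
    exact ⟨properAfterIntegration_of_continuousInputs hT hG₁ hG₂ hD fun yd hyd => (h4 yd hyd).1,
      (h4 _ (admissible_response_add hT hG₁ hG₂ hD 0)).2⟩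
  · exact hone yd hyd (ContinuousInputs.of_properAfterIntegration hT hG₁ hG₂ hD hyd h.1) h.2
  · obtain ⟨uinf, hrep, hlim⟩ := hdc.exists_limit hT hG₁ hG₂ hD hci
    have hdet := hdc.det_ne_zero
    have hresp := represents_response hT.le hG₁ hG₂ hD hrep.1
    -- Tracking is decided by the limit output, since `U_∞ = U_d` for every tracking input.
    have htr : S.Trackable T yd ↔ Set.EqOn (S.response uinf) yd (Set.Icc 0 T) := by
      refine ⟨fun ⟨ud, _, hud⟩ => ?_, trackable_of_eqOn_response hT hG₁ hG₂ hD hrep.1⟩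
      have h1 := (limit_eqUpTo_of_trackable hdet hrep.2 hud).mulVec S.G₁
      have h2 := (h1.trans hud).add (EqUpTo.refl S.disturbance)
      simp only [Plant.residual, sub_add_cancel] at h2
      exact hresp.eqOn hT ⟨hyd.1.continuousOn, h2⟩
    refine ⟨uinf, convergesUniformly_of_forall_isRun hT hG₁ hG₂ hD hci hrep.1 hlim, hrep.2.symm,
      fun ⟨ud, _, hud⟩ => ?_, fun u₀ hu₀ u y hr => ⟨⟨fun h => ?_, fun h t ht => ?_⟩, ?_⟩⟩
    · refine (limit_eqUpTo_of_trackable hdet hrep.2 hud).trans ?_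
      refine EqUpTo.trans ?_ (hud.mulVec _)
      refine EqUpTo.trans ?_ (evM_mul_mulVec _ S.G₁ _)
      rw [Matrix.mul_assoc, Matrix.nonsing_inv_mul _
        (isUnit_iff_ne_zero.2 (hdeg.det_transpose_mul_self_ne_zero hpq))]
      exact EqUpTo.of_eventuallyEq (Filter.Eventually.of_forall fun s => by simp)
    · exact htr.2 fun t ht => tendsto_nhds_unique ((hlim u₀ u y hr).2.tendsto_at ht) (h t ht)
    · rw [← htr.1 h ht]
      exact (hlim u₀ u y hr).2.tendsto_at ht
    · have hc := contDiffOn_response hT hG₁ hG₂ hD hrep.1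
      refine ⟨fun t => yd t - S.response uinf t, hyd.1.continuousOn.sub hc.continuousOn, ?_, ?_, ?_⟩
      · have h1 := (hlim u₀ u y hr).2
        rw [Metric.tendstoUniformlyOn_iff] at h1 ⊢
        intro ε hε
        filter_upwards [h1 ε hε] with k hk t ht
        rw [dist_sub_left]
        exact hk t ht
      · have h1 := (represents_laplace hyd.1.continuousOn).sub hT.le hresp
        refine h1.2.symm.trans ?_
        have h2 := (EqUpTo.refl (T := T) (S.residual T yd)).sub (hrep.2.mulVec S.G₁)
        refine EqUpTo.trans ?_ (h2.symm.trans ?_)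
        · refine EqUpTo.of_eventuallyEq (Filter.Eventually.of_forall fun s => ?_)
          simp only [Plant.output, Plant.residual]
          abel
        · refine EqUpTo.of_eventuallyEq ?_
          filter_upwards [evM_sub_eventually 1 (S.G₁ * (Γ * S.G₁)⁻¹ * Γ),
            evM_mul_eventually S.G₁ ((Γ * S.G₁)⁻¹ * Γ)] with s e1 e2
          rw [e1, Matrix.mul_assoc, e2, evM_one, Matrix.sub_mulVec, Matrix.one_mulVec,
            Matrix.mulVec_mulVec]
      · intro hntr
        by_contra! h0
        exact hntr (htr.2 fun t ht => (sub_eq_zero.1 (h0 t ht)).symm)
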